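/- Let $n\ge 2$, let $\Omega\subset\mathbb R^n$ be a bounded domain of class $C^{0,1}$, let $\Gamma\subseteq\partial\Omega$ be relatively open, let $T>0$, and put $Q_T=\Omega\times\,]0,T[$, $\Sigma_T=\Gamma\times\,]0,T[$. Assume: (A) $\mathsf A=[A_{ij}]:\Omega\to\mathbb R^{n\times n}$ is measurable, essentially bounded and uniformly elliptic: there is $a_\#>0$ with $A_{ij}(x)\xi_i\xi_j\ge a_\#|\xi|^2$ for a.e. $x\in\Omega$ and all $\xi\in\mathbb R^n$. (B) $2\le\ell\le 3$, and $b:\Gamma\times\mathbb R\to\mathbb R$ is a Carathéodory function for which there is $b^\#\ge 0$ such that, for a.e. $x\in\Gamma$ and all $\xi,\eta\in\mathbb R$, $0\le b(x,\xi)\le b^\#|\xi|^{\ell-2}$ and $(b(x,\xi)\xi-b(x,\eta)\eta)(\xi-\eta)\ge 0$. (E) $\mathbf E\in L^{2/(1-n/q-\theta)}(0,T;\mathbf L^q(\Omega))$ with $n<q<\infty$, where $\theta=0$ if $n>2$ and $0<\theta<1-2/q$ if $n=2$. Let $h\in L^2(\Sigma_T)$ with $h\ge 0$ a.e. on $\Sigma_T$,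 and let $u_0\in L^2(\Omega)$ with $u_0\ge 0$ a.e. in $\Omega$ (in particular, $u_0>0$ is allowed). Let $$u\in L^\infty(0,T;L^2(\Omega)),\qquad u\in L^2(0,T;H^1(\Omega)),\qquad \partial_t u\in L^2(0,T;[H^1(\Omega)]'),$$ with $u(0)=u_0$ (for the representative of $u$ in $C([0,T];L^2(\Omega))$), be a weak solution of $$\partial_t u-\nabla\cdot(\mathsf A\nabla u)=-\nabla\cdot(u\mathbf E)\ \text{ in }Q_T,$$ $$(\mathsf A\nabla u-u\mathbf E)\cdot\mathbf n=0\ \text{ on }(\partial\Omega\setminus\bar\Gamma)\times\,]0,T[,\qquad (\mathsf A\nabla u-u\mathbf E)\cdot\mathbf n+b(u)u=h\ \text{ on }\Sigma_T;$$ that is, for every $v\in L^2(0,T;H^1(\Omega))$ whose trace belongs to $L^\ell(\Sigma_T)$, the function $b(u)uv$ is integrable on $\Sigma_T$ and $$\int_0^T\langle\partial_t u,v\rangle\,dt+\int_{Q_T}\mathsf A\nabla u\cdot\nabla v\,dx\,dt+\int_{\Sigma_T}b(u)u\,v\,ds\,dt=\int_{Q_T}u\,\mathbf E\cdot\nabla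 v\,dx\,dt+\int_{\Sigma_T}h\,v\,ds\,dt .$$ Then $u\ge 0$ a.e. in $Q_T$, and the trace of $u$ is nonnegative a.e. on $\Sigma_T$. -/

import Mathlib

open MeasureTheory Set
open scoped ENNReal ContDiff

noncomputable section

namespace NeumannRobin

/-- The Euclidean space `ℝⁿ`. -/
abbrev Sp (n : ℕ) := EuclideanSpace ℝ (Fin n)

/-! ### The domain and its boundary -/

/-- Near `x`, after a choice of a unit "vertical" direction `e`, the set `Ω` is the region strictly
below the graph of a Lipschitz function of the coordinates orthogonal to `e`. -/
def IsLocallyLipschitzSubgraph {n : ℕ} (Ω : Set (Sp n)) (x : Sp n) : Prop :=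
  ∃ (e : Sp n) (K : NNReal) (γ : ((ℝ ∙ e)ᗮ : Submodule ℝ (Sp n)) → ℝ) (r : ℝ),
    ‖e‖ = 1 ∧ LipschitzWith K γ ∧ 0 < r ∧
    ∀ y ∈ Metric.ball x r, y ∈ Ω ↔ inner ℝ e y < γ ((ℝ ∙ e)ᗮ.orthogonalProjectionOnto y)

/-- Bounded domain (nonempty open connected set) of class `C^{0,1}`. -/
structure IsLipschitzDomain {n : ℕ} (Ω : Set (Sp n)) : Prop where
  isOpen : IsOpen Ω
  isConnected : IsConnected Ω
  isBounded : Bornology.IsBounded Ω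
  lipschitz_boundary : ∀ x ∈ frontier Ω, IsLocallyLipschitzSubgraph Ω x

/-- Lebesgue measure on `Ω`. -/
abbrev vol {n : ℕ} (Ω : Set (Sp n)) : Measure (Sp n) := volume.restrict Ω

/-- Surface measure on `∂Ω`: the `(n-1)`-dimensional Hausdorff measure, normalised as Lebesgue
measure on hyperplanes. -/
abbrev surf {n : ℕ} (Ω : Set (Sp n)) : Measure (Sp n) := (μHE[n - 1]).restrict (frontier Ω)

/-- The time interval `]0,T[` with Lebesgue measure. -/
abbrev timeMeasure (T : ℝ) : Measure ℝ := volume.restrict (Ioo 0 T)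

/-! ### The Sobolev space `H¹(Ω)` -/

/-- `G` is the weak gradient of `v` on `Ω`. -/
def IsWeakGradient {n : ℕ} (Ω : Set (Sp n)) (v : Sp n → ℝ) (G : Sp n → Sp n) : Prop :=
  ∀ φ : Sp n → ℝ, ContDiff ℝ ∞ φ → HasCompactSupport φ → tsupport φ ⊆ Ω →
    ∀ i : Fin n, ∫ x in Ω, v x * fderiv ℝ φ x (EuclideanSpace.single i 1) =
      - ∫ x in Ω, G x i * φ x

lemma integrable_mul_test {n : ℕ} {Ω : Set (Sp n)} {f : Sp n → ℝ} (hf : MemLp f 2 (vol Ω))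
    {φ : Sp n → ℝ} (hc : Continuous φ) (hs : HasCompactSupport φ) :
    Integrable (fun x => f x * φ x) (vol Ω) :=
  MemLp.integrable_mul (p := 2) (q := 2) hf (hc.memLp_of_hasCompactSupport hs)

lemma integrable_mul_dtest {n : ℕ} {Ω : Set (Sp n)} {f : Sp n → ℝ} (hf : MemLp f 2 (vol Ω))
    {φ : Sp n → ℝ} (hc : ContDiff ℝ ∞ φ) (hs : HasCompactSupport φ) (w : Sp n) :
    Integrable (fun x => f x * fderiv ℝ φ x w) (vol Ω) := by
  refine integrable_mul_test hf ?_ ?_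
  · exact (hc.continuous_fderiv (by simp)).clm_apply continuous_const
  · exact hs.fderiv_apply ℝ w

lemma memLp_coord {n : ℕ} {Ω : Set (Sp n)} (G : Lp (Sp n) 2 (vol Ω)) (i : Fin n) :
    MemLp (fun x => G x i) 2 (vol Ω) :=
  (EuclideanSpace.proj (𝕜 := ℝ) i).comp_memLp' (Lp.memLp G)

/-- The pairs `(v, ∇v)` with `v ∈ L²(Ω)` and weak gradient `∇v ∈ L²(Ω; ℝⁿ)`, as a subspace of
the Hilbert space `L²(Ω) × L²(Ω; ℝⁿ)`. -/
def h1Submodule {n : ℕ} (Ω : Set (Sp n)) :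
    Submodule ℝ (WithLp 2 (Lp ℝ 2 (vol Ω) × Lp (Sp n) 2 (vol Ω))) where
  carrier := {p | IsWeakGradient Ω p.fst p.snd}
  zero_mem' := by
    intro φ _ _ _ i
    have h1 : ∀ᵐ x ∂(vol Ω), (0 : Lp ℝ 2 (vol Ω)) x = 0 := Lp.coeFn_zero _ _ _
    have h2 : ∀ᵐ x ∂(vol Ω), (0 : Lp (Sp n) 2 (vol Ω)) x = 0 := Lp.coeFn_zero _ _ _
    have e1 : ∫ x in Ω, (0 : Lp ℝ 2 (vol Ω)) x * fderiv ℝ φ x (EuclideanSpace.single i 1) = 0 :=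
      integral_eq_zero_of_ae (by
        filter_upwards [h1] with x hx
        rw [hx, zero_mul, Pi.zero_apply])
    have e2 : ∫ x in Ω, (0 : Lp (Sp n) 2 (vol Ω)) x i * φ x = 0 :=
      integral_eq_zero_of_ae (by
        filter_upwards [h2] with x hx
        rw [hx, PiLp.zero_apply, zero_mul, Pi.zero_apply])
    rw [WithLp.zero_fst, WithLp.zero_snd, e1, e2, neg_zero]
  add_mem' := by
    intro p q hp hq φ hφ hs ht i
    have e1 : ∫ x in Ω, (p + q).fst x * fderiv ℝ φ x (EuclideanSpace.single i 1) =
        (∫ x in Ω, p.fst x * fderiv ℝ φ x (EuclideanSpace.single i 1)) +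
        ∫ x in Ω, q.fst x * fderiv ℝ φ x (EuclideanSpace.single i 1) := by
      rw [← integral_add (integrable_mul_dtest (Lp.memLp p.fst) hφ hs _)
        (integrable_mul_dtest (Lp.memLp q.fst) hφ hs _)]
      refine integral_congr_ae ?_
      filter_upwards [Lp.coeFn_add p.fst q.fst] with x hx
      rw [WithLp.add_fst, hx]
      simp only [Pi.add_apply, add_mul]
    have e2 : ∫ x in Ω, (p + q).snd x i * φ x =
        (∫ x in Ω, p.snd x i * φ x) + ∫ x in Ω, q.snd x i * φ x := by
      rw [← integral_add (integrable_mul_test (memLp_coord p.snd i) hφ.continuous hs)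
        (integrable_mul_test (memLp_coord q.snd i) hφ.continuous hs)]
      refine integral_congr_ae ?_
      filter_upwards [Lp.coeFn_add p.snd q.snd] with x hx
      rw [WithLp.add_snd, hx]
      simp only [Pi.add_apply, PiLp.add_apply, add_mul]
    rw [e1, e2, hp φ hφ hs ht i, hq φ hφ hs ht i, neg_add]
  smul_mem' := by
    intro c p hp φ hφ hs ht i
    have e1 : ∫ x in Ω, (c • p).fst x * fderiv ℝ φ x (EuclideanSpace.single i 1) =
        c * ∫ x in Ω, p.fst x * fderiv ℝ φ x (EuclideanSpace.single i 1) := by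
      rw [← integral_const_mul]
      refine integral_congr_ae ?_
      filter_upwards [Lp.coeFn_smul c p.fst] with x hx
      simp [hx, mul_assoc]
    have e2 : ∫ x in Ω, (c • p).snd x i * φ x = c * ∫ x in Ω, p.snd x i * φ x := by
      rw [← integral_const_mul]
      refine integral_congr_ae ?_
      filter_upwards [Lp.coeFn_smul c p.snd] with x hx
      simp [hx, mul_assoc]
    rw [e1, e2, hp φ hφ hs ht i, mul_neg]

/-- The Sobolev space `H¹(Ω)`, with the norm `(‖v‖² + ‖∇v‖²)^{1/2}`. -/
def H1 {n : ℕ} (Ω : Set (Sp n)) : Type := h1Submodule Ω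

instance {n : ℕ} (Ω : Set (Sp n)) : NormedAddCommGroup (H1 Ω) :=
  inferInstanceAs (NormedAddCommGroup (h1Submodule Ω))

instance {n : ℕ} (Ω : Set (Sp n)) : InnerProductSpace ℝ (H1 Ω) :=
  inferInstanceAs (InnerProductSpace ℝ (h1Submodule Ω))

/-- The underlying `L²` function of an element of `H¹(Ω)`. -/
def val {n : ℕ} {Ω : Set (Sp n)} (v : H1 Ω) : Lp ℝ 2 (vol Ω) :=
  v.1.fst

/-- The weak gradient of an element of `H¹(Ω)`. -/
def grad {n : ℕ} {Ω : Set (Sp n)} (v : H1 Ω) : Lp (Sp n) 2 (vol Ω) :=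
  v.1.snd

/-! ### The trace on the boundary -/

/-- A bounded operator `H¹(Ω) → L²(∂Ω)` which is restriction to `∂Ω` on `H¹(Ω) ∩ C(Ω̄)`. -/
def IsTraceOperator {n : ℕ} (Ω : Set (Sp n)) (S : H1 Ω →L[ℝ] Lp ℝ 2 (surf Ω)) : Prop :=
  ∀ (v : H1 Ω) (φ : Sp n → ℝ), ContinuousOn φ (closure Ω) →
    (∀ᵐ x ∂(vol Ω), val v x = φ x) → ∀ᵐ x ∂(surf Ω), S v x = φ x

open Classical in
/-- The trace operator `H¹(Ω) → L²(∂Ω)`. On a bounded Lipschitz domain there is exactly one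
operator with the property `IsTraceOperator`, by the trace theorem and the density of
`H¹(Ω) ∩ C(Ω̄)` in `H¹(Ω)`; the value `0` is only used where there is none. -/
def trace {n : ℕ} (Ω : Set (Sp n)) : H1 Ω →L[ℝ] Lp ℝ 2 (surf Ω) :=
  if h : ∃ S, IsTraceOperator Ω S then h.choose else 0

/-! ### The data -/

/-- Coefficient matrix: measurable, uniformly elliptic and bounded on `Ω`. -/
structure IsEllipticMatrix {n : ℕ} (Ω : Set (Sp n)) (A : Sp n → Matrix (Fin n) (Fin n) ℝ) :
    Prop where
  measurable : ∀ i j, AEStronglyMeasurable (fun x => A x i j) (vol Ω)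
  elliptic : ∃ a : ℝ, 0 < a ∧ ∀ᵐ x ∂(vol Ω), ∀ ξ : Sp n,
    a * ‖ξ‖ ^ 2 ≤ ∑ i, ∑ j, A x i j * ξ i * ξ j
  bounded : ∃ a : ℝ, 0 < a ∧ ∀ᵐ x ∂(vol Ω), ∀ i j, |A x i j| ≤ a

/-- Boundary coefficient: a Carathéodory function on `Γ × ℝ` with
`0 ≤ b(x,ξ) ≤ b^# |ξ|^{ℓ-2}` and `ξ ↦ b(x,ξ) ξ` monotone. -/
structure IsBoundaryCoefficient {n : ℕ} (Ω Γ : Set (Sp n)) (ℓ : ℝ) (b : Sp n → ℝ → ℝ) :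
    Prop where
  measurable : ∀ ξ, AEStronglyMeasurable (fun x => b x ξ) ((surf Ω).restrict Γ)
  continuous : ∀ᵐ x ∂((surf Ω).restrict Γ), Continuous (b x)
  growth : ∃ bsup : ℝ, 0 ≤ bsup ∧ ∀ᵐ x ∂((surf Ω).restrict Γ), ∀ ξ : ℝ,
    0 ≤ b x ξ ∧ b x ξ ≤ bsup * |ξ| ^ (ℓ - 2)
  monotone : ∀ᵐ x ∂((surf Ω).restrict Γ), ∀ ξ η : ℝ,
    0 ≤ (b x ξ * ξ - b x η * η) * (ξ - η)

/-! ### Solutions -/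

/-- The test space `L²(0,T; V_{2,ℓ}) ∩ L^ℓ(Σ_T)`, where `V_{2,ℓ}` is the space of the
`v ∈ H¹(Ω)` with trace in `L^ℓ(Γ)`. For `ℓ ≥ 2` it consists of the `v ∈ L²(0,T; H¹(Ω))` whose
trace belongs to `L^ℓ(Σ_T)`, because `L^ℓ(Σ_T) = L^ℓ(0,T; L^ℓ(Γ)) ⊆ L²(0,T; L^ℓ(Γ))`. -/
def IsTest {n : ℕ} (Ω Γ : Set (Sp n)) (T ℓ : ℝ) (v : ℝ → H1 Ω) : Prop :=
  MemLp v 2 (timeMeasure T) ∧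
    ∫⁻ t in Ioo 0 T, ∫⁻ x in Γ, ‖trace Ω (v t) x‖ₑ ^ ℓ ∂(surf Ω) < ⊤

/-- `g` is the distributional derivative on `]0,T[` of `u`, as functions with values in
`[H¹(Ω)]'`, where `H¹(Ω) ⊆ L²(Ω) ⊆ [H¹(Ω)]'` through the inner product of `L²(Ω)`. -/
def IsTimeDerivative {n : ℕ} {Ω : Set (Sp n)} (T : ℝ) (u : ℝ → H1 Ω)
    (g : ℝ → (H1 Ω →L[ℝ] ℝ)) : Prop :=
  ∀ ψ : ℝ → ℝ, ContDiff ℝ ∞ ψ → HasCompactSupport ψ → tsupport ψ ⊆ Ioo 0 T →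
    ∀ w : H1 Ω, ∫ t in Ioo 0 T, ψ t * g t w =
      - ∫ t in Ioo 0 T, deriv ψ t * inner ℝ (val (u t)) (val w)

/-- `u(0) = u₀`: the representative of `u` in `C([0,T]; L²(Ω))` has the value `u₀` at `t = 0`. -/
def HasInitialValue {n : ℕ} {Ω : Set (Sp n)} (T : ℝ) (u : ℝ → H1 Ω) (u0 : Lp ℝ 2 (vol Ω)) :
    Prop :=
  ∃ U : ℝ → Lp ℝ 2 (vol Ω), ContinuousOn U (Icc 0 T) ∧
    (∀ᵐ t ∂(timeMeasure T), U t = val (u t)) ∧ U 0 = u0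

/-- `u` is a weak solution, in `L^∞(0,T; L²(Ω)) ∩ W^{1,2}(0,T; H¹(Ω), [H¹(Ω)]')`, of
* `∂ₜu - ∇·(A∇u) = -∇·(uE)` in `Q_T`,
* `(A∇u - uE)·n = 0` on `(∂Ω ∖ Γ̄) × ]0,T[`,
* `(A∇u - uE)·n + b(u)u = h` on `Σ_T = Γ × ]0,T[`,
* `u(0) = u₀` in `Ω`.

A function on `Q_T` or `Σ_T` is a function of time with values in a space of functions on `Ω` or
`Γ`, and space-time integrals are iterated. The integral of `b(u)uv` is required to exist. -/
structure IsWeakSolution {n : ℕ} (Ω Γ : Set (Sp n)) (T ℓ : ℝ)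
    (A : Sp n → Matrix (Fin n) (Fin n) ℝ) (b : Sp n → ℝ → ℝ)
    {q : ℝ≥0∞} (E : ℝ → Lp (Sp n) q (vol Ω))
    (h : ℝ → Lp ℝ 2 ((surf Ω).restrict Γ)) (u0 : Lp ℝ 2 (vol Ω)) (u : ℝ → H1 Ω) : Prop where
  memLp_top : MemLp (fun t => val (u t)) ⊤ (timeMeasure T)
  memLp_two : MemLp u 2 (timeMeasure T)
  initial : HasInitialValue T u u0
  equation : ∃ u' : ℝ → (H1 Ω →L[ℝ] ℝ), MemLp u' 2 (timeMeasure T) ∧ IsTimeDerivative T u u' ∧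
    ∀ v : ℝ → H1 Ω, IsTest Ω Γ T ℓ v →
      (∫⁻ t in Ioo 0 T, ∫⁻ x in Γ,
        ‖b x (trace Ω (u t) x) * trace Ω (u t) x * trace Ω (v t) x‖ₑ ∂(surf Ω)) < ⊤ ∧
      (∫ t in Ioo 0 T, u' t (v t)) +
        (∫ t in Ioo 0 T, ∫ x in Ω, ∑ i, ∑ j, A x i j * grad (u t) x j * grad (v t) x i) +
        (∫ t in Ioo 0 T, ∫ x in Γ,
          b x (trace Ω (u t) x) * trace Ω (u t) x * trace Ω (v t) x ∂(surf Ω)) =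
      (∫ t in Ioo 0 T, ∫ x in Ω, val (u t) x * inner ℝ (E t x) (grad (v t) x)) +
        ∫ t in Ioo 0 T, ∫ x in Γ, h t x * trace Ω (v t) x ∂(surf Ω)

end NeumannRobin

end

/-!
The equation is tested with `v(t) = (T - t) β(u(t))`, where `β = cutoff ε` is the function
`β(s) = -(s⁻)² / (ε + (s⁻)²)`. It is of class `C¹` with bounded derivative, nondecreasing, vanishes
for `s ≥ 0` and takes values in `[-1, 0]`; as `ε → 0` it tends to minus the indicator function of
`s < 0`. The terms of the equation behave as follows.

* The elliptic term is nonnegative because `β' ≥ 0`, the boundary term because `s β(s) ≥ 0` and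
  `b ≥ 0`, and the term with `h ≥ 0` has a sign because `β ≤ 0`.
* The time term is formally the integral of `(T - t) m'(t)` with the negative mass
  `m(t) = ∫_Ω j(u(t)) dx` (`negMass`), where `j(s) = ∫₀ˢ β ≥ 0` is convex and vanishes for `s ≥ 0`.
  As `u₀ ≥ 0`, `m(0) = 0`, and integration by parts turns the time term into the integral of `m`.
  Since `u` has only a derivative with values in `[H¹(Ω)]'`, the inequality that is needed
  (`integral_le_integral_weight_mul_apply`) is obtained through difference quotients: the
  convexity of `j` bounds `m(t) - m(t - h)` by the pairing of `u(t) - u(t - h)` with `β(u(t))`,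
  and the Steklov averages of `∂ₜu` that appear converge.
* The drift term is the integral of `(T - t) E · (u β'(u) ∇u)`. Since `|s β'(s)| ≤ 1`, and
  `s β'(s) → 0` for each `s` as `ε → 0`, it tends to `0` by dominated convergence
  (`tendsto_drift`). The only property of `E` that enters is `E ∈ L²(Q_T)`; the weight in the
  test function and the boundedness of `β` replace the Sobolev and Gronwall inequalities.

The negative mass for `ε = 1` is bounded by the one for `ε ≤ 1`, hence it vanishes and `u ≥ 0`.

The test function has to be in `L²(0,T; H¹(Ω))`, with a bounded trace. This is the chain rule in
`H¹(Ω)` (`compPair_mem`) together with the formula `trace (β(v)) = β(trace v)` (`trace_comp`). Both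
hold for restrictions of `C¹` functions on `ℝⁿ`, and extend to all of `H¹(Ω)` because these are
dense on a bounded Lipschitz domain (`IsLipschitzDomain.dense_smoothH1`): locally, an element of
`H¹(Ω)` is translated into the domain along a cone and mollified. The formula for the trace also
gives the second claim: for `v ≥ 0` we have `β(v) = 0`, so that `β(trace v) = 0`, that is,
`trace v ≥ 0` (`trace_nonneg`).
-/

namespace NeumannRobin

/-! ### Averages of translates in `L²` -/

section Mollification

variable {G F : Type*} [NormedAddCommGroup G] [NormedSpace ℝ G] [FiniteDimensional ℝ G]
  [MeasurableSpace G] [BorelSpace G] {μ : Measure G} [μ.IsAddHaarMeasure]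
  [NormedAddCommGroup F]

/-- Translations act continuously on `L²`. -/
lemma exists_eLpNorm_translate_sub_le {f : G → F} (hf : MemLp f 2 μ) {ε : ℝ≥0∞} (hε : 0 < ε) :
    ∃ δ > 0, ∀ z : G, ‖z‖ < δ → eLpNorm (fun x => f (x - z) - f x) 2 μ ≤ ε := by
  have : Fact ((2 : ℝ≥0∞) ≠ ⊤) := ⟨by simp⟩
  let g : Lp F 2 μ := hf.toLp f
  have hc : Continuous fun z : G => (DomAddAct.mk (-z)) +ᵥ g := by
    have h1 : Continuous fun z : G => DomAddAct.mk (-z) :=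
      DomAddAct.continuous_mk.comp continuous_neg
    exact h1.vadd continuous_const
  have h0 : (DomAddAct.mk (-(0 : G))) +ᵥ g = g := by simp
  have ht := hc.tendsto 0
  simp only [h0] at ht
  have ht' := (EMetric.tendsto_nhds.1 ht ε hε)
  obtain ⟨δ, hδ, H⟩ := Metric.eventually_nhds_iff.1 ht'
  refine ⟨δ, hδ, fun z hz => ?_⟩
  have h2 := (H (y := z) (by simpa using hz)).le
  rw [Lp.edist_def] at h2
  refine (eLpNorm_congr_ae ?_).trans_le h2
  have h3 := DomAddAct.vadd_Lp_ae_eq (DomAddAct.mk (-z)) g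
  have h4 := (measurePreserving_sub_right μ z).quasiMeasurePreserving.ae hf.coeFn_toLp
  filter_upwards [h3, h4, hf.coeFn_toLp] with x hx3 hx4 hx5
  simp only [Pi.sub_apply]
  rw [hx3, hx5]
  simp only [Equiv.symm_apply_apply, vadd_eq_add, neg_add_eq_sub]
  rw [hx4]

variable [NormedSpace ℝ F]

lemma eLpNorm_two_sq {α E : Type*} [MeasurableSpace α] [NormedAddCommGroup E] (ν : Measure α)
    (f : α → E) : eLpNorm f 2 ν ^ 2 = ∫⁻ x, ‖f x‖ₑ ^ 2 ∂ν := by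
  have := eLpNorm_nnreal_pow_eq_lintegral (μ := ν) (f := f) (p := 2) (by simp)
  simpa using this

/-- Jensen's inequality for the square of the norm of a mean value. -/
lemma enorm_integral_sq_le {α : Type*} [MeasurableSpace α] (ν : Measure α) [IsProbabilityMeasure ν]
    {f : α → F} (hf : AEStronglyMeasurable f ν) :
    ‖∫ z, f z ∂ν‖ₑ ^ 2 ≤ ∫⁻ z, ‖f z‖ₑ ^ 2 ∂ν := by
  rw [← eLpNorm_two_sq]
  gcongr
  refine (enorm_integral_le_lintegral_enorm f).trans ?_
  rw [← eLpNorm_one_eq_lintegral_enorm]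
  exact eLpNorm_le_eLpNorm_of_exponent_le (by simp) hf

/-- Averages of the translates of an `L²` function over small translations are close to the
function in `L²`; the averages are taken with respect to a probability measure `ν`. -/
lemma exists_eLpNorm_average_translate_sub_le [CompleteSpace F] {f : G → F}
    (hm : StronglyMeasurable f)
    (hf : MemLp f 2 μ) {ε : ℝ≥0∞} (hε : 0 < ε) :
    ∃ δ > 0, ∀ ν : Measure G, IsProbabilityMeasure ν → (∀ᵐ z ∂ν, ‖z‖ < δ) →
      eLpNorm (fun x => (∫ z, f (x - z) ∂ν) - f x) 2 μ ≤ ε := by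
  obtain ⟨δ, hδ, H⟩ := exists_eLpNorm_translate_sub_le hf hε
  refine ⟨δ, hδ, fun ν hν hsupp => ?_⟩
  have hm2 : StronglyMeasurable fun p : G × G => f (p.1 - p.2) :=
    hm.comp_measurable measurable_sub
  have hslice : ∀ x, StronglyMeasurable fun z => f (x - z) := fun x =>
    hm.comp_measurable (measurable_const.sub measurable_id)
  -- For almost every `x` the function `z ↦ f (x - z)` is in `L²(ν)`, hence `ν`-integrable.
  have hint : ∀ᵐ x ∂μ, Integrable (fun z => f (x - z)) ν := by
    have h1 : ∫⁻ x, ∫⁻ z, ‖f (x - z)‖ₑ ^ 2 ∂ν ∂μ < ⊤ := by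
      rw [lintegral_lintegral_swap (hm2.enorm.pow_const 2).aemeasurable]
      have h2 : ∀ z, ∫⁻ x, ‖f (x - z)‖ₑ ^ 2 ∂μ = eLpNorm f 2 μ ^ 2 := fun z => by
        rw [eLpNorm_two_sq]
        exact lintegral_sub_right_eq_self (fun x => ‖f x‖ₑ ^ 2) z
      simp only [h2, lintegral_const, measure_univ, mul_one]
      exact ENNReal.pow_lt_top hf.2
    have h3 := ae_lt_top (hm2.enorm.pow_const 2).lintegral_prod_right' h1.ne
    filter_upwards [h3] with x hx
    have : MemLp (fun z => f (x - z)) 2 ν := by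
      refine ⟨(hslice x).aestronglyMeasurable, ?_⟩
      rw [← eLpNorm_two_sq] at hx
      by_contra hcon
      simp only [not_lt, top_le_iff] at hcon
      simp [hcon] at hx
    exact this.integrable (by simp)
  have key : eLpNorm (fun x => (∫ z, f (x - z) ∂ν) - f x) 2 μ ^ 2 ≤ ε ^ 2 := by
    rw [eLpNorm_two_sq]
    calc ∫⁻ x, ‖(∫ z, f (x - z) ∂ν) - f x‖ₑ ^ 2 ∂μ
        ≤ ∫⁻ x, ∫⁻ z, ‖f (x - z) - f x‖ₑ ^ 2 ∂ν ∂μ := by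
          refine lintegral_mono_ae ?_
          filter_upwards [hint] with x hx
          have e : (∫ z, f (x - z) ∂ν) - f x = ∫ z, (f (x - z) - f x) ∂ν := by
            rw [integral_sub hx (integrable_const _)]
            simp
          rw [e]
          exact enorm_integral_sq_le ν
            ((hslice x).sub stronglyMeasurable_const).aestronglyMeasurable
      _ = ∫⁻ z, ∫⁻ x, ‖f (x - z) - f x‖ₑ ^ 2 ∂μ ∂ν := by
          refine lintegral_lintegral_swap (f := fun x z => ‖f (x - z) - f x‖ₑ ^ 2) ?_
          exact ((hm2.sub (hm.comp_measurable measurable_fst)).enorm.pow_const 2).aemeasurable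
      _ ≤ ∫⁻ z, ε ^ 2 ∂ν := by
          refine lintegral_mono_ae ?_
          filter_upwards [hsupp] with z hz
          rw [← eLpNorm_two_sq]
          gcongr
          exact H z hz
      _ = ε ^ 2 := by simp
  exact (ENNReal.pow_le_pow_left_iff two_ne_zero).1 key

end Mollification

/-! ### The space `H¹(Ω)` -/

section Sobolev

variable {n : ℕ} {Ω : Set (Sp n)}

lemma val_add (v w : H1 Ω) : val (v + w) = val v + val w := rfl

lemma val_sub (v w : H1 Ω) : val (v - w) = val v - val w := rfl

lemma val_smul (c : ℝ) (v : H1 Ω) : val (c • v) = c • val v := rfl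

lemma grad_add (v w : H1 Ω) : grad (v + w) = grad v + grad w := rfl

lemma grad_sub (v w : H1 Ω) : grad (v - w) = grad v - grad w := rfl

lemma grad_smul (c : ℝ) (v : H1 Ω) : grad (c • v) = c • grad v := rfl

lemma H1.norm_sq (v : H1 Ω) : ‖v‖ ^ 2 = ‖val v‖ ^ 2 + ‖grad v‖ ^ 2 :=
  WithLp.prod_norm_sq_eq_of_L2 v.1

lemma norm_val_le (v : H1 Ω) : ‖val v‖ ≤ ‖v‖ :=
  le_of_sq_le_sq (by rw [H1.norm_sq]; nlinarith [sq_nonneg ‖grad v‖]) (norm_nonneg v)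

lemma norm_grad_le (v : H1 Ω) : ‖grad v‖ ≤ ‖v‖ :=
  le_of_sq_le_sq (by rw [H1.norm_sq]; nlinarith [sq_nonneg ‖val v‖]) (norm_nonneg v)

lemma H1.norm_le (v : H1 Ω) : ‖v‖ ≤ ‖val v‖ + ‖grad v‖ :=
  le_of_sq_le_sq (by rw [H1.norm_sq]; nlinarith [norm_nonneg (val v), norm_nonneg (grad v)])
    (by positivity)

lemma continuous_val : Continuous (val : H1 Ω → Lp ℝ 2 (vol Ω)) :=
  (WithLp.continuous_fst _ _ _).comp continuous_subtype_val

lemma continuous_grad : Continuous (grad : H1 Ω → Lp (Sp n) 2 (vol Ω)) :=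
  (WithLp.continuous_snd _ _ _).comp continuous_subtype_val

lemma H1.ext {v w : H1 Ω} (h1 : val v = val w) (h2 : grad v = grad w) : v = w := by
  rw [← sub_eq_zero, ← norm_le_zero_iff]
  refine (H1.norm_le _).trans ?_
  rw [val_sub, grad_sub, h1, h2]
  simp

lemma isWeakGradient_grad (v : H1 Ω) : IsWeakGradient Ω (val v) (grad v) := v.2

lemma IsWeakGradient.congr {f f' : Sp n → ℝ} {G G' : Sp n → Sp n} (h : IsWeakGradient Ω f G)
    (hf : f =ᵐ[vol Ω] f') (hG : G =ᵐ[vol Ω] G') : IsWeakGradient Ω f' G' := by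
  intro φ h1 h2 h3 i
  have e1 : ∫ x in Ω, f' x * fderiv ℝ φ x (EuclideanSpace.single i 1) =
      ∫ x in Ω, f x * fderiv ℝ φ x (EuclideanSpace.single i 1) :=
    integral_congr_ae (by filter_upwards [hf] with x hx; rw [hx])
  have e2 : ∫ x in Ω, G' x i * φ x = ∫ x in Ω, G x i * φ x :=
    integral_congr_ae (by filter_upwards [hG] with x hx; rw [hx])
  rw [e1, e2, h φ h1 h2 h3 i]

lemma exists_h1 {f : Sp n → ℝ} {G : Sp n → Sp n} (hf : MemLp f 2 (vol Ω)) (hG : MemLp G 2 (vol Ω))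
    (h : IsWeakGradient Ω f G) : ∃ v : H1 Ω, val v =ᵐ[vol Ω] f ∧ grad v =ᵐ[vol Ω] G :=
  ⟨⟨WithLp.toLp 2 (hf.toLp f, hG.toLp G),
    h.congr hf.coeFn_toLp.symm hG.coeFn_toLp.symm⟩, hf.coeFn_toLp, hG.coeFn_toLp⟩

lemma isClosed_h1Submodule : IsClosed (h1Submodule Ω : Set
    (WithLp 2 (Lp ℝ 2 (vol Ω) × Lp (Sp n) 2 (vol Ω)))) := by
  have e : (h1Submodule Ω : Set (WithLp 2 (Lp ℝ 2 (vol Ω) × Lp (Sp n) 2 (vol Ω)))) =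
      {p | ∀ φ : Sp n → ℝ, ContDiff ℝ ∞ φ → HasCompactSupport φ → tsupport φ ⊆ Ω →
        ∀ i : Fin n, ∫ x in Ω, p.fst x * fderiv ℝ φ x (EuclideanSpace.single i 1) =
          - ∫ x in Ω, p.snd x i * φ x} := rfl
  rw [e]
  simp only [ofPred_forall]
  refine isClosed_iInter fun φ => isClosed_iInter fun h1 => isClosed_iInter fun h2 =>
    isClosed_iInter fun _ => isClosed_iInter fun i => ?_
  have hφ : MemLp φ 2 (vol Ω) := h1.continuous.memLp_of_hasCompactSupport h2
  have hdφ : MemLp (fun x => fderiv ℝ φ x (EuclideanSpace.single i 1)) 2 (vol Ω) :=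
    ((h1.continuous_fderiv (by simp)).clm_apply continuous_const).memLp_of_hasCompactSupport
      (h2.fderiv_apply ℝ _)
  have hφi : MemLp (fun x => EuclideanSpace.single i (φ x) : Sp n → Sp n) 2 (vol Ω) := by
    have : (fun x => EuclideanSpace.single i (φ x) : Sp n → Sp n) =
        fun x => φ x • (EuclideanSpace.single i 1 : Sp n) := by
      ext x j; simp
    rw [this]
    exact (ContinuousLinearMap.toSpanSingleton ℝ (EuclideanSpace.single i 1 : Sp n)).comp_memLp' hφ
  refine isClosed_eq ?_ (Continuous.neg ?_)
  · have e1 : (fun p : WithLp 2 (Lp ℝ 2 (vol Ω) × Lp (Sp n) 2 (vol Ω)) =>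
        ∫ x in Ω, p.fst x * fderiv ℝ φ x (EuclideanSpace.single i 1)) =
        fun p => inner ℝ (hdφ.toLp _) p.fst := by
      ext p
      rw [L2.inner_def]
      refine integral_congr_ae ?_
      filter_upwards [hdφ.coeFn_toLp] with x hx
      simp [hx]
    rw [e1]
    exact continuous_const.inner (WithLp.continuous_fst _ _ _)
  · have e1 : (fun p : WithLp 2 (Lp ℝ 2 (vol Ω) × Lp (Sp n) 2 (vol Ω)) =>
        ∫ x in Ω, p.snd x i * φ x) = fun p => inner ℝ (hφi.toLp _) p.snd := by
      ext p
      rw [L2.inner_def]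
      refine integral_congr_ae ?_
      filter_upwards [hφi.coeFn_toLp] with x hx
      simp [hx, EuclideanSpace.inner_single_left, mul_comm]
    rw [e1]
    exact continuous_const.inner (WithLp.continuous_snd _ _ _)

lemma gradient_apply {F : Sp n → ℝ} (x : Sp n) (i : Fin n) :
    gradient F x i = fderiv ℝ F x (EuclideanSpace.single i 1) := by
  rw [← toDual_gradient, InnerProductSpace.toDual_apply_apply, EuclideanSpace.inner_single_right]
  simp

lemma continuous_gradient {F : Sp n → ℝ} (hF : ContDiff ℝ 1 F) : Continuous (gradient F) :=
  (InnerProductSpace.toDual ℝ (Sp n)).symm.continuous.comp (hF.continuous_fderiv (by simp))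

/-- Integration by parts: the classical gradient of a `C¹` function is its weak gradient. -/
lemma isWeakGradient_gradient {F : Sp n → ℝ} (hF : ContDiff ℝ 1 F) :
    IsWeakGradient Ω F (gradient F) := by
  intro φ h1 h2 h3 i
  have hz : ∀ x, x ∉ Ω → φ x = 0 := fun x hx => image_eq_zero_of_notMem_tsupport fun h => hx (h3 h)
  have hz' : ∀ x, x ∉ Ω → fderiv ℝ φ x = 0 := fun x hx =>
    fderiv_of_notMem_tsupport (𝕜 := ℝ) fun h => hx (h3 h)
  rw [setIntegral_eq_integral_of_forall_compl_eq_zero (fun x hx => by simp [hz' x hx]),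
    setIntegral_eq_integral_of_forall_compl_eq_zero (fun x hx => by simp [hz x hx])]
  simp only [gradient_apply]
  have hφ' := h1.continuous_fderiv (by simp)
  have hF' := hF.continuous_fderiv (by simp)
  refine integral_mul_fderiv_eq_neg_fderiv_mul_of_integrable ?_ ?_ ?_
    (fun x _ => hF.differentiable (by simp) x) (fun x _ => h1.differentiable (by simp) x)
  · exact ((hF'.clm_apply continuous_const).mul h1.continuous).integrable_of_hasCompactSupport
      h2.mul_left
  · exact (hF.continuous.mul (hφ'.clm_apply continuous_const)).integrable_of_hasCompactSupport
      (h2.fderiv_apply ℝ _).mul_left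
  · exact (hF.continuous.mul h1.continuous).integrable_of_hasCompactSupport h2.mul_left

lemma memLp_of_continuous_of_isBounded (hb : Bornology.IsBounded Ω) {E : Type*}
    [NormedAddCommGroup E] {f : Sp n → E}
    (hf : Continuous f) (p : ℝ≥0∞) : MemLp f p (vol Ω) := by
  have hK := hb.isCompact_closure
  have : IsFiniteMeasure (volume.restrict (closure Ω)) := ⟨by simpa using hK.measure_lt_top⟩
  obtain ⟨C, hC⟩ := hK.exists_bound_of_continuousOn hf.continuousOn
  have h1 : MemLp f p (volume.restrict (closure Ω)) :=
    MemLp.of_bound hf.aestronglyMeasurable C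
      ((ae_restrict_mem isClosed_closure.measurableSet).mono hC)
  exact h1.mono_measure (Measure.restrict_mono subset_closure le_rfl)

lemma memLp_smul_of_bounded {α E : Type*} [MeasurableSpace α] {ν : Measure α}
    [NormedAddCommGroup E] [NormedSpace ℝ E] {f : α → E} {p : ℝ≥0∞}
    (hf : MemLp f p ν) {φ : α → ℝ} (hφ : AEStronglyMeasurable φ ν) {C : ℝ} (hC : ∀ x, |φ x| ≤ C) :
    MemLp (fun x => φ x • f x) p ν :=
  hf.smul (r := p) (memLp_top_of_bound hφ C (Filter.Eventually.of_forall hC))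

/-- The product of an element of `H¹(Ω)` with a test function on `ℝⁿ`. -/
lemma exists_mul_test (v : H1 Ω) {ψ : Sp n → ℝ} (hψ : ContDiff ℝ ∞ ψ) (hs : HasCompactSupport ψ) :
    ∃ w : H1 Ω, val w =ᵐ[vol Ω] (fun x => ψ x * val v x) ∧
      grad w =ᵐ[vol Ω] fun x => ψ x • grad v x + val v x • gradient ψ x := by
  have hψ1 : ContDiff ℝ 1 ψ := hψ.of_le (by exact_mod_cast le_top)
  obtain ⟨C, hC⟩ := hs.exists_bound_of_continuous hψ.continuous
  have hgs : HasCompactSupport (gradient ψ) :=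
    (hs.fderiv ℝ).comp_left (g := (InnerProductSpace.toDual ℝ (Sp n)).symm) (by simp)
  have hgm : MemLp (fun x => val v x • gradient ψ x) 2 (vol Ω) :=
    MemLp.smul (p := 2) (q := ⊤) (r := 2)
      ((continuous_gradient hψ1).memLp_of_hasCompactSupport hgs) (Lp.memLp (val v))
  refine exists_h1 (memLp_smul_of_bounded (Lp.memLp (val v)) hψ.continuous.aestronglyMeasurable hC)
    ((memLp_smul_of_bounded (Lp.memLp (grad v)) hψ.continuous.aestronglyMeasurable hC).add hgm) ?_
  intro φ h1 h2 h3 i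
  have hv := isWeakGradient_grad v (fun x => ψ x * φ x) (hψ.mul h1) h2.mul_left
    ((tsupport_mul_subset_right).trans h3) i
  have hd : ∀ x, fderiv ℝ (fun x => ψ x * φ x) x (EuclideanSpace.single i 1) =
      ψ x * fderiv ℝ φ x (EuclideanSpace.single i 1) + φ x * gradient ψ x i := by
    intro x
    rw [fderiv_fun_mul (hψ.differentiable (by simp) x) (h1.differentiable (by simp) x)]
    simp [gradient_apply]
  have hc1 : ContDiff ℝ ∞ fun x => ψ x * φ x := hψ.mul h1
  have i1 : Integrable (fun x => ψ x * val v x * fderiv ℝ φ x (EuclideanSpace.single i 1))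
      (vol Ω) :=
    integrable_mul_dtest
      (memLp_smul_of_bounded (Lp.memLp (val v)) hψ.continuous.aestronglyMeasurable hC) h1 h2 _
  have i2 : Integrable (fun x => val v x * (φ x * gradient ψ x i)) (vol Ω) :=
    integrable_mul_test (Lp.memLp (val v)) (h1.continuous.mul (by
      simp only [gradient_apply]
      exact (hψ.continuous_fderiv (by simp)).clm_apply continuous_const)) h2.mul_right
  have i3 : Integrable (fun x => grad v x i * (ψ x * φ x)) (vol Ω) :=
    integrable_mul_test (memLp_coord _ i) hc1.continuous h2.mul_left
  have e1 : ∫ x in Ω, val v x * fderiv ℝ (fun x => ψ x * φ x) x (EuclideanSpace.single i 1) =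
      (∫ x in Ω, ψ x * val v x * fderiv ℝ φ x (EuclideanSpace.single i 1)) +
        ∫ x in Ω, val v x * (φ x * gradient ψ x i) := by
    rw [← integral_add i1 i2]
    refine integral_congr_ae (Filter.Eventually.of_forall fun x => ?_)
    simp only [hd]
    ring
  have e2 : ∫ x in Ω, (ψ x • grad v x + val v x • gradient ψ x) i * φ x =
      (∫ x in Ω, grad v x i * (ψ x * φ x)) + ∫ x in Ω, val v x * (φ x * gradient ψ x i) := by
    rw [← integral_add i3 i2]
    refine integral_congr_ae (Filter.Eventually.of_forall fun x => ?_)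
    simp only [PiLp.add_apply, PiLp.smul_apply, smul_eq_mul]
    ring
  rw [e2]
  linarith

end Sobolev

/-! ### Density of smooth functions in `H¹(Ω)` -/

section Density

open scoped Convolution

variable {n : ℕ} {Ω : Set (Sp n)}

/-- The elements of `H¹(Ω)` that are restrictions of `C¹` functions on `ℝⁿ`, with the classical
gradient. -/
def smoothH1 (Ω : Set (Sp n)) : Submodule ℝ (H1 Ω) where
  carrier := {v | ∃ F : Sp n → ℝ, ContDiff ℝ 1 F ∧ val v =ᵐ[vol Ω] F ∧
    grad v =ᵐ[vol Ω] gradient F}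
  zero_mem' := by
    refine ⟨fun _ => 0, contDiff_const, Lp.coeFn_zero _ _ _, (Lp.coeFn_zero _ _ _).trans ?_⟩
    filter_upwards with x
    simp
  add_mem' := by
    rintro v w ⟨F, hF, hv, hv'⟩ ⟨G, hG, hw, hw'⟩
    refine ⟨fun x => F x + G x, hF.add hG, ?_, ?_⟩
    · filter_upwards [Lp.coeFn_add (val v) (val w), hv, hw] with x h1 h2 h3
      rw [val_add, h1, Pi.add_apply, h2, h3]
    · filter_upwards [Lp.coeFn_add (grad v) (grad w), hv', hw'] with x h1 h2 h3
      rw [grad_add, h1, Pi.add_apply, h2, h3]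
      ext i
      simp only [PiLp.add_apply, gradient_apply]
      rw [fderiv_fun_add (hF.differentiable (by simp) x) (hG.differentiable (by simp) x)]
      simp
  smul_mem' := by
    rintro c v ⟨F, hF, hv, hv'⟩
    refine ⟨fun x => c * F x, contDiff_const.mul hF, ?_, ?_⟩
    · filter_upwards [Lp.coeFn_smul c (val v), hv] with x h1 h2
      rw [val_smul, h1, Pi.smul_apply, h2, smul_eq_mul]
    · filter_upwards [Lp.coeFn_smul c (grad v), hv'] with x h1 h2
      rw [grad_smul, h1, Pi.smul_apply, h2]
      ext i
      simp only [PiLp.smul_apply, gradient_apply]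
      rw [fderiv_const_mul (hF.differentiable (by simp) x)]
      simp

lemma exists_mem_smoothH1 (hb : Bornology.IsBounded Ω) {F : Sp n → ℝ} (hF : ContDiff ℝ 1 F) :
    ∃ v ∈ smoothH1 Ω, val v =ᵐ[vol Ω] F ∧ grad v =ᵐ[vol Ω] gradient F := by
  obtain ⟨v, h1, h2⟩ := exists_h1 (memLp_of_continuous_of_isBounded hb hF.continuous 2)
    (memLp_of_continuous_of_isBounded hb (continuous_gradient hF) 2) (isWeakGradient_gradient hF)
  exact ⟨v, ⟨F, hF, h1, h2⟩, h1, h2⟩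

/-- The interior cone property of a Lipschitz domain: near a point `x₀` of `Ω̄`, moving a point of
`Ω` by a small vector of a fixed cone with axis `-e` gives a point of `Ω`. For `x₀ ∈ Ω` the axis
plays no role. -/
lemma IsLipschitzDomain.exists_cone (hΩ : IsLipschitzDomain Ω) {x₀ : Sp n} (hx₀ : x₀ ∈ closure Ω) :
    ∃ (e : Sp n) (r c δ₀ : ℝ), 0 < r ∧ 0 < c ∧ 0 < δ₀ ∧ ∀ δ, 0 < δ → δ ≤ δ₀ → ∀ x ∈ Ω,
      ∀ y ∈ Metric.ball x₀ r, ‖x - y - δ • e‖ ≤ c * δ → y ∈ Ω := by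
  by_cases hx : x₀ ∈ Ω
  · obtain ⟨r, hr, h⟩ := Metric.isOpen_iff.1 hΩ.isOpen x₀ hx
    exact ⟨0, r, 1, 1, hr, one_pos, one_pos, fun _ _ _ _ _ y hy _ => h hy⟩
  obtain ⟨e, K, γ, R, he, hγ, hR, hsub⟩ := hΩ.lipschitz_boundary x₀
    (by rw [hΩ.isOpen.frontier_eq]; exact ⟨hx₀, hx⟩)
  have hK : (0 : ℝ) ≤ K := K.2
  set c : ℝ := 1 / (2 * (1 + K)) with hc
  have hc0 : 0 < c := by positivity
  have hcK : c * (1 + K) = 1 / 2 := by rw [hc]; field_simp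
  have hc1 : c ≤ 1 / 2 := by nlinarith
  refine ⟨e, R / 2, c, R / 4, by positivity, hc0, by positivity, ?_⟩
  intro δ hδ hδR x hxΩ y hy hxy
  rw [Metric.mem_ball, dist_eq_norm] at hy
  set z := x - y - δ • e with hz
  have hxyz : x = y + (δ • e + z) := by rw [hz]; abel
  have hxb : x ∈ Metric.ball x₀ R := by
    rw [Metric.mem_ball, dist_eq_norm]
    have e1 : x - x₀ = (y - x₀) + (δ • e + z) := by rw [hxyz]; abel
    have e2 : ‖δ • e‖ = δ := by rw [norm_smul, he, mul_one, Real.norm_of_nonneg hδ.le]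
    calc ‖x - x₀‖ ≤ ‖y - x₀‖ + (‖δ • e‖ + ‖z‖) := by
          rw [e1]; exact (norm_add_le _ _).trans (by gcongr; exact norm_add_le _ _)
      _ < R := by rw [e2]; nlinarith
  have hyb : y ∈ Metric.ball x₀ R := by
    rw [Metric.mem_ball, dist_eq_norm]; linarith
  have h1 := (hsub x hxb).1 hxΩ
  rw [hsub y hyb]
  set P := (ℝ ∙ e)ᗮ.orthogonalProjectionOnto with hP
  have hPe : P e = 0 := by
    rw [hP, Submodule.orthogonalProjectionOnto_eq_zero_iff, Submodule.orthogonal_orthogonal]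
    exact Submodule.mem_span_singleton_self e
  have hPx : P x - P y = P z := by
    rw [hxyz]; simp [hPe]
  have h2 : γ (P x) ≤ γ (P y) + K * ‖z‖ := by
    have := hγ.dist_le_mul (P x) (P y)
    rw [Real.dist_eq, dist_eq_norm, hPx] at this
    have h3 : ‖P z‖ ≤ ‖z‖ := Submodule.norm_orthogonalProjectionOnto_apply_le _ z
    have h4 := (abs_le.1 this).2
    nlinarith
  have h3 : inner ℝ e x = inner ℝ e y + δ + inner ℝ e z := by
    rw [hxyz, inner_add_right, inner_add_right, inner_smul_right, real_inner_self_eq_norm_sq, he]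
    ring
  have h4 : |inner ℝ e z| ≤ ‖z‖ := by simpa [he] using abs_real_inner_le_norm e z
  have h5 := (abs_le.1 h4).1
  nlinarith

lemma norm_sub_le_of_ae {α E : Type*} [MeasurableSpace α] [NormedAddCommGroup E] {ν : Measure α}
    {p : ℝ≥0∞} {F G : Lp E p ν} {f g : α → E} (hF : F =ᵐ[ν] f) (hG : G =ᵐ[ν] g) {η : ℝ} (hη : 0 ≤ η)
    (h : eLpNorm (fun x => f x - g x) p ν ≤ ENNReal.ofReal η) : ‖F - G‖ ≤ η := by
  rw [Lp.norm_def]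
  refine ENNReal.toReal_le_of_le_ofReal hη ?_
  rwa [eLpNorm_congr_ae ((Lp.coeFn_sub F G).trans (hF.sub hG))]

/-- The probability measure with density a normalised bump function, paired with a function. -/
lemma integral_normed_withDensity {E : Type*} [NormedAddCommGroup E] [NormedSpace ℝ E] {c : Sp n}
    (b : ContDiffBump c) (g : Sp n → E) :
    ∫ z, g z ∂(volume.withDensity fun z => ENNReal.ofReal (b.normed volume z)) =
      ∫ z, b.normed volume z • g z := by
  rw [integral_withDensity_eq_integral_toReal_smul
    (b.continuous_normed.measurable.ennreal_ofReal) (by simp)]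
  simp only [ENNReal.toReal_ofReal (b.nonneg_normed _)]

lemma isProbabilityMeasure_normed {c : Sp n} (b : ContDiffBump c) :
    IsProbabilityMeasure (volume.withDensity fun z => ENNReal.ofReal (b.normed volume z)) := by
  refine ⟨?_⟩
  rw [withDensity_apply _ MeasurableSet.univ, Measure.restrict_univ,
    ← ofReal_integral_eq_lintegral_ofReal b.integrable_normed
      (Filter.Eventually.of_forall b.nonneg_normed), b.integral_normed, ENNReal.ofReal_one]

lemma ae_norm_lt_normed {c : Sp n} (b : ContDiffBump c) {δ : ℝ} (hδ : ‖c‖ + b.rOut < δ) :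
    ∀ᵐ z ∂(volume.withDensity fun z => ENNReal.ofReal (b.normed volume z)), ‖z‖ < δ := by
  rw [ae_withDensity_iff b.continuous_normed.measurable.ennreal_ofReal]
  refine Filter.Eventually.of_forall fun z hz => ?_
  have h1 : z ∈ Function.support (b.normed volume) := by
    intro h; simp [h] at hz
  rw [b.support_normed_eq, Metric.mem_ball, dist_eq_norm] at h1
  calc ‖z‖ = ‖c + (z - c)‖ := by abel_nf
    _ ≤ ‖c‖ + ‖z - c‖ := norm_add_le _ _
    _ < δ := by linarith

/-- The mollification `x ↦ ∫ ψ v ρ(x - ·)` of `ψ v`, where the kernel `ρ` is such that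
`supp ψ ∩ supp ρ(x - ·) ⊆ Ω`, has as gradient at `x` the mollification of the weak gradient of
`ψ v`: the function `ψ ρ(x - ·)` is a test function on `Ω`. -/
lemma fderiv_mollification (hΩ : IsOpen Ω) (v : H1 Ω) {ψ : Sp n → ℝ} (hψ : ContDiff ℝ ∞ ψ)
    (hs : HasCompactSupport ψ) {ρ : Sp n → ℝ} (hρ : ContDiff ℝ ∞ ρ) (hρs : HasCompactSupport ρ)
    {x : Sp n} (hx : ∀ y ∈ tsupport ψ, x - y ∈ tsupport ρ → y ∈ Ω) (i : Fin n) :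
    fderiv ℝ (fun x => ∫ y, Ω.indicator (fun y => ψ y * val v y) y * ρ (x - y)) x
        (EuclideanSpace.single i 1) =
      ∫ y, Ω.indicator (fun y => ψ y • grad v y + val v y • gradient ψ y) y i * ρ (x - y) := by
  obtain ⟨C, hC⟩ := hs.exists_bound_of_continuous hψ.continuous
  have hψv : MemLp (fun y => ψ y * val v y) 2 (vol Ω) :=
    memLp_smul_of_bounded (Lp.memLp (val v)) hψ.continuous.aestronglyMeasurable hC
  have hf : MemLp (Ω.indicator fun y => ψ y * val v y) 2 volume :=
    (memLp_indicator_iff_restrict hΩ.measurableSet).2 hψv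
  have hloc : LocallyIntegrable (Ω.indicator fun y => ψ y * val v y) volume :=
    hf.locallyIntegrable (by simp)
  have hρ1 : ContDiff ℝ 1 ρ := hρ.of_le (by exact_mod_cast le_top)
  have hd := (hρs.hasFDerivAt_convolution_right (ContinuousLinearMap.mul ℝ ℝ) hloc hρ1 x).fderiv
  have e0 : (fun x => ∫ y, Ω.indicator (fun y => ψ y * val v y) y * ρ (x - y)) =
    (Ω.indicator (fun y => ψ y * val v y)) ⋆[ContinuousLinearMap.mul ℝ ℝ] ρ := rfl
  rw [e0, hd, convolution_precompR_apply _ hloc (hρs.fderiv ℝ) (hρ1.continuous_fderiv (by simp))]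
  have e1 : ((Ω.indicator (fun y => ψ y * val v y)) ⋆[ContinuousLinearMap.mul ℝ ℝ]
      fun a => fderiv ℝ ρ a (EuclideanSpace.single i 1)) x =
      ∫ y in Ω, val v y * (ψ y * fderiv ℝ ρ (x - y) (EuclideanSpace.single i 1)) := by
    rw [← integral_indicator hΩ.measurableSet]
    refine integral_congr_ae (Filter.Eventually.of_forall fun y => ?_)
    by_cases hy : y ∈ Ω
    · simp only [indicator_of_mem hy, ContinuousLinearMap.mul_apply']; ring
    · simp [indicator_of_notMem hy]
  have e2 : ∫ y, Ω.indicator (fun y => ψ y • grad v y + val v y • gradient ψ y) y i * ρ (x - y) =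
      ∫ y in Ω, (grad v y i * (ψ y * ρ (x - y)) + val v y * (ρ (x - y) * gradient ψ y i)) := by
    rw [← integral_indicator hΩ.measurableSet]
    refine integral_congr_ae (Filter.Eventually.of_forall fun y => ?_)
    by_cases hy : y ∈ Ω
    · simp only [indicator_of_mem hy, PiLp.add_apply, PiLp.smul_apply, smul_eq_mul]; ring
    · simp [indicator_of_notMem hy]
  rw [e1, e2]
  -- The test function `ψ ρ(x - ·)`.
  have hρx : ContDiff ℝ ∞ fun y => ρ (x - y) := hρ.comp (contDiff_const.sub contDiff_id)
  have hφ : ContDiff ℝ ∞ fun y => ψ y * ρ (x - y) := hψ.mul hρx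
  have hφs : HasCompactSupport fun y => ψ y * ρ (x - y) := hs.mul_right
  have hsub : tsupport (fun y => ψ y * ρ (x - y)) ⊆ Ω := by
    intro y hy
    refine hx y (tsupport_mul_subset_left hy) ?_
    have h1 : y ∈ tsupport fun y => ρ (x - y) := tsupport_mul_subset_right hy
    have h2 : tsupport (fun y => ρ (x - y)) ⊆ (fun y => x - y) ⁻¹' tsupport ρ :=
      tsupport_comp_subset_preimage ρ (by fun_prop)
    exact h2 h1
  have hdρ : ∀ y, fderiv ℝ (fun y => ρ (x - y)) y (EuclideanSpace.single i 1) =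
      - fderiv ℝ ρ (x - y) (EuclideanSpace.single i 1) := by
    intro y
    have h1 := (hρ.differentiable (by simp) (x - y)).hasFDerivAt.comp y
      ((hasFDerivAt_id y).const_sub x)
    have h2 : fderiv ℝ (fun y => ρ (x - y)) y = _ := h1.fderiv
    rw [h2]
    simp
  have hdφ : ∀ y, fderiv ℝ (fun y => ψ y * ρ (x - y)) y (EuclideanSpace.single i 1) =
      ρ (x - y) * gradient ψ y i - ψ y * fderiv ℝ ρ (x - y) (EuclideanSpace.single i 1) := by
    intro y
    rw [fderiv_fun_mul (hψ.differentiable (by simp) y) (hρx.differentiable (by simp) y)]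
    simp only [add_apply, smul_apply, hdρ, smul_eq_mul,
      gradient_apply]
    ring
  have hv := isWeakGradient_grad v _ hφ hφs hsub i
  have hρ' : Continuous fun y => fderiv ℝ ρ (x - y) (EuclideanSpace.single i 1) :=
    ((hρ1.continuous_fderiv (by simp)).comp (continuous_const.sub continuous_id)).clm_apply
      continuous_const
  have i1 : Integrable (fun y => val v y *
      (ψ y * fderiv ℝ ρ (x - y) (EuclideanSpace.single i 1))) (vol Ω) :=
    integrable_mul_test (Lp.memLp (val v)) (hψ.continuous.mul hρ') hs.mul_right
  have hgi : Continuous fun y => gradient ψ y i := by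
    simp only [gradient_apply]
    exact (hψ.continuous_fderiv (by simp)).clm_apply continuous_const
  have hgs : HasCompactSupport fun y => gradient ψ y i := by
    simp only [gradient_apply]
    exact hs.fderiv_apply ℝ _
  have i2 : Integrable (fun y => val v y * (ρ (x - y) * gradient ψ y i)) (vol Ω) :=
    integrable_mul_test (Lp.memLp (val v)) (hρx.continuous.mul hgi) hgs.mul_left
  have i3 : Integrable (fun y => grad v y i * (ψ y * ρ (x - y))) (vol Ω) :=
    integrable_mul_test (memLp_coord _ i) hφ.continuous hφs
  have e3 : ∫ y in Ω, val v y * fderiv ℝ (fun y => ψ y * ρ (x - y)) y (EuclideanSpace.single i 1) =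
      (∫ y in Ω, val v y * (ρ (x - y) * gradient ψ y i)) -
        ∫ y in Ω, val v y * (ψ y * fderiv ℝ ρ (x - y) (EuclideanSpace.single i 1)) := by
    rw [← integral_sub i2 i1]
    refine integral_congr_ae (Filter.Eventually.of_forall fun y => ?_)
    simp only [hdφ]
    ring
  rw [integral_add i3 i2]
  linarith

/-- Elements of `H¹(Ω)` multiplied by a cut-off function with small support are limits of
restrictions of `C¹` functions: they are mollified with kernels supported in the cone of
directions that point into `Ω`. -/
lemma IsLipschitzDomain.exists_ball_mul_test_mem_closure (hΩ : IsLipschitzDomain Ω) {x₀ : Sp n}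
    (hx₀ : x₀ ∈ closure Ω) : ∃ r > 0, ∀ ψ : Sp n → ℝ, ContDiff ℝ ∞ ψ → HasCompactSupport ψ →
      tsupport ψ ⊆ Metric.ball x₀ r → ∀ v w : H1 Ω, val w =ᵐ[vol Ω] (fun x => ψ x * val v x) →
      grad w =ᵐ[vol Ω] (fun x => ψ x • grad v x + val v x • gradient ψ x) →
      w ∈ (smoothH1 Ω).topologicalClosure := by
  obtain ⟨e, r, c, δ₀, hr, hc, hδ₀, hcone⟩ := hΩ.exists_cone hx₀
  refine ⟨r, hr, fun ψ hψ hs hψr v w hw hw' => ?_⟩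
  have hΩm := hΩ.isOpen.measurableSet
  have hψ1 : ContDiff ℝ 1 ψ := hψ.of_le (by exact_mod_cast le_top)
  set f : Sp n → ℝ := Ω.indicator fun y => ψ y * val v y with hf
  set g : Sp n → Sp n := Ω.indicator fun y => ψ y • grad v y + val v y • gradient ψ y with hg
  have hfm : StronglyMeasurable f :=
    (hψ.continuous.stronglyMeasurable.mul (Lp.stronglyMeasurable (val v))).indicator hΩm
  have hgm : StronglyMeasurable g :=
    ((hψ.continuous.stronglyMeasurable.smul (Lp.stronglyMeasurable (grad v))).add
      ((Lp.stronglyMeasurable (val v)).smul (continuous_gradient hψ1).stronglyMeasurable)).indicator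
      hΩm
  have hf2 : MemLp f 2 volume :=
    (memLp_indicator_iff_restrict hΩm).2 ((memLp_congr_ae hw).1 (Lp.memLp (val w)))
  have hg2 : MemLp g 2 volume :=
    (memLp_indicator_iff_restrict hΩm).2 ((memLp_congr_ae hw').1 (Lp.memLp (grad w)))
  have hwf : val w =ᵐ[vol Ω] f := by
    filter_upwards [hw, ae_restrict_mem hΩm] with x h1 h2
    rw [h1, hf, indicator_of_mem h2]
  have hwg : grad w =ᵐ[vol Ω] g := by
    filter_upwards [hw', ae_restrict_mem hΩm] with x h1 h2
    rw [h1, hg, indicator_of_mem h2]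
  rw [← SetLike.mem_coe, Submodule.topologicalClosure_coe, Metric.mem_closure_iff]
  intro η hη
  have hη3 : 0 < ENNReal.ofReal (η / 3) := ENNReal.ofReal_pos.2 (by positivity)
  obtain ⟨δ₁, hδ₁, hK₁⟩ := exists_eLpNorm_average_translate_sub_le hfm hf2 hη3
  obtain ⟨δ₂, hδ₂, hK₂⟩ := exists_eLpNorm_average_translate_sub_le hgm hg2 hη3
  obtain ⟨δ, hδ, hδle⟩ : ∃ δ, 0 < δ ∧ δ ≤ δ₀ ∧ δ * (‖e‖ + c) < min δ₁ δ₂ := by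
    set m := min δ₁ δ₂ with hm
    have hm0 : 0 < m := lt_min hδ₁ hδ₂
    have hp : 0 < ‖e‖ + c := by positivity
    refine ⟨min δ₀ (m / (2 * (‖e‖ + c))), lt_min hδ₀ (by positivity), min_le_left _ _, ?_⟩
    calc min δ₀ (m / (2 * (‖e‖ + c))) * (‖e‖ + c) ≤ m / (2 * (‖e‖ + c)) * (‖e‖ + c) := by
          gcongr; exact min_le_right _ _
      _ = m / 2 := by field_simp
      _ < m := by linarith
  let b : ContDiffBump (δ • e) := ⟨c * δ / 2, c * δ, by positivity, by nlinarith [mul_pos hc hδ]⟩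
  set ρ := b.normed volume with hρdef
  have hρ : ContDiff ℝ ∞ ρ := b.contDiff_normed (n := ⊤)
  have hρs : HasCompactSupport ρ := b.hasCompactSupport_normed
  set ν := volume.withDensity fun z => ENNReal.ofReal (ρ z) with hν
  have hprob : IsProbabilityMeasure ν := isProbabilityMeasure_normed b
  have hnorm : ‖δ • e‖ + b.rOut < min δ₁ δ₂ := by
    have : ‖δ • e‖ + b.rOut = δ * (‖e‖ + c) := by
      rw [norm_smul, Real.norm_of_nonneg hδ.le]
      change δ * ‖e‖ + c * δ = _
      ring
    rw [this]; exact hδle.2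
  have K1 := hK₁ ν hprob (ae_norm_lt_normed b (hnorm.trans_le (min_le_left _ _)))
  have K2 := hK₂ ν hprob (ae_norm_lt_normed b (hnorm.trans_le (min_le_right _ _)))
  -- The mollified function `F` and its gradient.
  have hint : ∀ {E : Type} [NormedAddCommGroup E] [NormedSpace ℝ E] (u : Sp n → E) (x : Sp n),
      ∫ z, u (x - z) ∂ν = ∫ y, ρ (x - y) • u y := by
    intro E _ _ u x
    rw [hν, integral_normed_withDensity b,
      ← integral_sub_left_eq_self (fun y => ρ (x - y) • u y) volume x]
    simp [hρdef]
  set F : Sp n → ℝ := fun x => ∫ y, f y * ρ (x - y) with hF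
  have hF1 : ContDiff ℝ 1 F := by
    refine hρs.contDiff_convolution_right (ContinuousLinearMap.mul ℝ ℝ)
      (hf2.locallyIntegrable (by simp)) (n := 1) (hρ.of_le ?_)
    exact_mod_cast le_top
  have hFν : ∀ x, F x = ∫ z, f (x - z) ∂ν := by
    intro x
    rw [hint]
    simp only [hF, smul_eq_mul, mul_comm]
  have hgrad : ∀ x ∈ Ω, gradient F x = ∫ z, g (x - z) ∂ν := by
    intro x hx
    ext i
    rw [gradient_apply, hF, hf, fderiv_mollification hΩ.isOpen v hψ hs hρ hρs ?_ i, hint]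
    · have hi : Integrable (fun y => ρ (x - y) • g y) volume := by
        have hρx : MemLp (fun y => ρ (x - y)) 2 volume :=
          (hρ.continuous.memLp_of_hasCompactSupport hρs).comp_measurePreserving
            (Measure.measurePreserving_sub_left volume x)
        exact memLp_one_iff_integrable.1 (hg2.smul hρx)
      have := (EuclideanSpace.proj (𝕜 := ℝ) i : Sp n →L[ℝ] ℝ).integral_comp_comm hi
      rw [PiLp.proj_apply] at this
      rw [← this]
      refine integral_congr_ae (Filter.Eventually.of_forall fun y => ?_)
      simp [hg, mul_comm]
    · intro y hy hxy
      rw [hρdef, b.tsupport_normed_eq, Metric.mem_closedBall, dist_eq_norm] at hxy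
      exact hcone δ hδ hδle.1 x hx y (hψr hy) hxy
  obtain ⟨s, hsm, hs1, hs2⟩ := exists_mem_smoothH1 hΩ.isBounded hF1
  refine ⟨s, hsm, ?_⟩
  have n1 : ‖val s - val w‖ ≤ η / 3 := by
    refine norm_sub_le_of_ae hs1 hwf (by positivity) ?_
    refine (eLpNorm_mono_measure _ Measure.restrict_le_self).trans ?_
    simpa only [hFν] using K1
  have n2 : ‖grad s - grad w‖ ≤ η / 3 := by
    refine norm_sub_le_of_ae (f := fun x => ∫ z, g (x - z) ∂ν) ?_ hwg (by positivity) ?_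
    · filter_upwards [hs2, ae_restrict_mem hΩm] with x h1 h2
      rw [h1, hgrad x h2]
    · exact (eLpNorm_mono_measure _ Measure.restrict_le_self).trans K2
  rw [dist_comm, dist_eq_norm]
  calc ‖s - w‖ ≤ ‖val s - val w‖ + ‖grad s - grad w‖ := H1.norm_le (s - w)
    _ < η := by linarith

/-- On a bounded Lipschitz domain the restrictions of `C¹` functions are dense in `H¹(Ω)`. The
domain is covered by finitely many balls on which the local statement applies; multiplying an
element of `H¹(Ω)` successively by `1 - f` for cut-off functions `f` of these balls does not change
its class modulo the closure, and gives `0`. -/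
theorem IsLipschitzDomain.dense_smoothH1 (hΩ : IsLipschitzDomain Ω) :
    Dense (smoothH1 Ω : Set (H1 Ω)) := by
  rw [Submodule.dense_iff_topologicalClosure_eq_top, eq_top_iff]
  intro v _
  set D := (smoothH1 Ω).topologicalClosure with hD
  have hloc := fun (x : Sp n) (hx : x ∈ closure Ω) => hΩ.exists_ball_mul_test_mem_closure hx
  choose! r hr hloc using hloc
  obtain ⟨t, htK, ht⟩ := hΩ.isBounded.isCompact_closure.elim_nhds_subcover
    (fun x => Metric.ball x (r x / 4))
    fun x hx => Metric.ball_mem_nhds x (by have := hr x hx; positivity)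
  have key : ∀ s : Finset (Sp n), s ⊆ t → ∃ w : H1 Ω, v - w ∈ D ∧ ∀ᵐ y ∂(vol Ω), ∀ x ∈ s,
      y ∈ Metric.ball x (r x / 4) → val w y = 0 ∧ grad w y = 0 := by
    classical
    intro s
    induction s using Finset.induction_on with
    | empty => exact fun _ => ⟨v, by simp, by simp⟩
    | insert x s hxs ih =>
      intro hst
      obtain ⟨w, hw, hw0⟩ := ih ((Finset.subset_insert x s).trans hst)
      have hx := htK x (hst (Finset.mem_insert_self x s))
      have hrx := hr x hx
      let b : ContDiffBump x := ⟨r x / 4, r x / 2, by positivity, by linarith⟩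
      obtain ⟨m, hm, hm'⟩ := exists_mul_test w (ψ := b) b.contDiff b.hasCompactSupport
      have hmD : m ∈ D := hloc x hx b b.contDiff b.hasCompactSupport (by
        rw [b.tsupport_eq]
        exact Metric.closedBall_subset_ball (by change r x / 2 < r x; linarith)) w m hm hm'
      refine ⟨w - m, ?_, ?_⟩
      · have : v - (w - m) = (v - w) + m := by abel
        rw [this]
        exact D.add_mem hw hmD
      · filter_upwards [hw0, hm, hm', Lp.coeFn_sub (val w) (val m), Lp.coeFn_sub (grad w) (grad m)]
          with y h1 h2 h3 h4 h5 x' hx' hy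
        rw [val_sub, grad_sub, h4, h5, Pi.sub_apply, Pi.sub_apply, h2, h3]
        rcases Finset.mem_insert.1 hx' with rfl | hx'
        · have e1 : b y = 1 := b.one_of_mem_closedBall (Metric.ball_subset_closedBall hy)
          have e2 : gradient b y = 0 := by
            ext i
            rw [gradient_apply, (b.eventuallyEq_one_of_mem_ball hy).fderiv_eq]
            simp
          simp [e1, e2]
        · obtain ⟨e1, e2⟩ := h1 x' hx' hy
          simp [e1, e2]
  obtain ⟨w, hw, hw0⟩ := key t subset_rfl
  have hall : ∀ᵐ y ∂(vol Ω), val w y = 0 ∧ grad w y = 0 := by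
    filter_upwards [hw0, ae_restrict_mem hΩ.isOpen.measurableSet] with y h1 h2
    obtain ⟨x, hx, hy⟩ := mem_iUnion₂.1 (ht (subset_closure h2))
    exact h1 x hx hy
  have : w = 0 := by
    refine H1.ext ?_ ?_
    · refine Lp.ext ?_
      filter_upwards [hall, Lp.coeFn_zero ℝ 2 (vol Ω)] with y h1 h2
      rw [h1.1]
      exact h2.symm
    · refine Lp.ext ?_
      filter_upwards [hall, Lp.coeFn_zero (Sp n) 2 (vol Ω)] with y h1 h2
      rw [h1.2]
      exact h2.symm
  simpa [this] using hw

end Density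

/-! ### Superposition operators, the chain rule and the trace -/

section Superposition

open Filter Topology
open scoped NNReal

variable {α E : Type*} [MeasurableSpace α] {ν : Measure α} [NormedAddCommGroup E] [NormedSpace ℝ E]
  {γ : ℝ → ℝ} {M : ℝ≥0}

/-- The element `x ↦ γ(f(x)) g(x)` of `L²`, for `f, g ∈ L²` and `γ` continuous and bounded. -/
noncomputable def smulComp (hγ : Continuous γ) (hM : ∀ s, |γ s| ≤ M) (f : Lp ℝ 2 ν)
    (g : Lp E 2 ν) : Lp E 2 ν :=
  (memLp_smul_of_bounded (Lp.memLp g)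
    (hγ.comp_aestronglyMeasurable (Lp.aestronglyMeasurable f)) fun _ => hM _).toLp
      (fun x => γ (f x) • g x)

lemma coeFn_smulComp (hγ : Continuous γ) (hM : ∀ s, |γ s| ≤ M) (f : Lp ℝ 2 ν)
    (g : Lp E 2 ν) : smulComp hγ hM f g =ᵐ[ν] fun x => γ (f x) • g x :=
  MemLp.coeFn_toLp _

lemma norm_smulComp_le (hγ : Continuous γ) (hM : ∀ s, |γ s| ≤ M) (f : Lp ℝ 2 ν)
    (g : Lp E 2 ν) : ‖smulComp hγ hM f g‖ ≤ M * ‖g‖ := by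
  refine Lp.norm_le_mul_norm_of_ae_le_mul ?_
  filter_upwards [coeFn_smulComp hγ hM f g] with x hx
  rw [hx, norm_smul]
  exact mul_le_mul_of_nonneg_right (hM _) (norm_nonneg _)

lemma smulComp_sub (hγ : Continuous γ) (hM : ∀ s, |γ s| ≤ M) (f : Lp ℝ 2 ν)
    (g g' : Lp E 2 ν) : smulComp hγ hM f g - smulComp hγ hM f g' = smulComp hγ hM f (g - g') := by
  refine Lp.ext ?_
  filter_upwards [Lp.coeFn_sub (smulComp hγ hM f g) (smulComp hγ hM f g'), coeFn_smulComp hγ hM f g,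
    coeFn_smulComp hγ hM f g', coeFn_smulComp hγ hM f (g - g'), Lp.coeFn_sub g g']
    with x h1 h2 h3 h4 h5
  rw [h1, h4, h5, Pi.sub_apply, Pi.sub_apply, h2, h3, smul_sub]

/-- `γ(f) g` depends continuously on `f` and `g` in `L²`: for fixed `g` this is dominated
convergence along a subsequence. -/
lemma continuous_smulComp (hγ : Continuous γ) (hM : ∀ s, |γ s| ≤ M) :
    Continuous fun p : Lp ℝ 2 ν × Lp E 2 ν => smulComp hγ hM p.1 p.2 := by
  rw [continuous_iff_seqContinuous]
  intro u p hu
  refine tendsto_of_subseq_tendsto fun ns hns => ?_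
  have hu1 : Tendsto (fun k => (u (ns k)).1) atTop (𝓝 p.1) :=
    (continuous_fst.tendsto p).comp (hu.comp hns)
  have hu2 : Tendsto (fun k => (u (ns k)).2) atTop (𝓝 p.2) :=
    (continuous_snd.tendsto p).comp (hu.comp hns)
  obtain ⟨ms, hms, hae⟩ := (tendstoInMeasure_of_tendsto_Lp hu1).exists_seq_tendsto_ae
  refine ⟨ms, ?_⟩
  set f := fun k => (u (ns (ms k))).1
  set g := fun k => (u (ns (ms k))).2
  have hg : Tendsto g atTop (𝓝 p.2) := hu2.comp hms.tendsto_atTop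
  change Tendsto (fun k => smulComp hγ hM (f k) (g k)) atTop (𝓝 (smulComp hγ hM p.1 p.2))
  have h1 : Tendsto (fun k => smulComp hγ hM (f k) (g k) - smulComp hγ hM (f k) p.2) atTop
      (𝓝 0) := by
    refine squeeze_zero_norm (a := fun k => M * ‖g k - p.2‖) (fun k => ?_) ?_
    · rw [smulComp_sub]
      exact norm_smulComp_le _ _ _ _
    · have := (tendsto_iff_norm_sub_tendsto_zero.1 hg).const_mul (M : ℝ)
      simpa using this
  have h2 : Tendsto (fun k => smulComp hγ hM (f k) p.2) atTop (𝓝 (smulComp hγ hM p.1 p.2)) := by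
    rw [Lp.tendsto_Lp_iff_tendsto_eLpNorm']
    have h3 : Tendsto (fun k => ∫⁻ x, ‖(γ (f k x) - γ (p.1 x)) • p.2 x‖ₑ ^ 2 ∂ν) atTop
        (𝓝 (∫⁻ _, 0 ∂ν)) := by
      refine tendsto_lintegral_of_dominated_convergence'
        (fun x => ‖(2 * M : ℝ) • p.2 x‖ₑ ^ 2) (fun k => ?_) (fun k => ?_) ?_ ?_
      · exact ((((hγ.comp_aestronglyMeasurable (Lp.aestronglyMeasurable (f k))).sub
          (hγ.comp_aestronglyMeasurable (Lp.aestronglyMeasurable p.1))).smul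
          (Lp.aestronglyMeasurable p.2)).enorm).pow_const 2
      · refine Eventually.of_forall fun x => ?_
        dsimp only
        gcongr ?_ ^ 2
        rw [enorm_le_iff_norm_le, norm_smul, norm_smul, Real.norm_eq_abs, Real.norm_eq_abs]
        refine mul_le_mul_of_nonneg_right ?_ (norm_nonneg _)
        refine le_trans ?_ (le_abs_self (2 * (M : ℝ)))
        have a1 := abs_le.1 (hM (f k x))
        have a2 := abs_le.1 (hM (p.1 x))
        exact abs_le.2 ⟨by linarith, by linarith⟩
      · rw [← eLpNorm_two_sq]
        exact (ENNReal.pow_lt_top ((Lp.memLp p.2).const_smul _).2).ne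
      · filter_upwards [hae] with x hx
        have h4 : Tendsto (fun k => (γ (f k x) - γ (p.1 x)) • p.2 x) atTop (𝓝 0) := by
          have := ((hγ.tendsto _).comp hx).sub_const (γ (p.1 x))
          simp only [sub_self] at this
          simpa using this.smul_const (p.2 x)
        have h5 := ((ENNReal.continuous_pow 2).tendsto _).comp
          ((continuous_enorm.tendsto _).comp h4)
        simpa [Function.comp_def] using h5
    rw [lintegral_zero] at h3
    have h6 : ∀ k,
        eLpNorm (fun x => smulComp hγ hM (f k) p.2 x - smulComp hγ hM p.1 p.2 x) 2 ν ^ 2 =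
        ∫⁻ x, ‖(γ (f k x) - γ (p.1 x)) • p.2 x‖ₑ ^ 2 ∂ν := by
      intro k
      rw [eLpNorm_two_sq]
      refine lintegral_congr_ae ?_
      filter_upwards [coeFn_smulComp hγ hM (f k) p.2, coeFn_smulComp hγ hM p.1 p.2] with x a1 a2
      rw [a1, a2, sub_smul]
    simp only [← h6] at h3
    have h7 := ((ENNReal.continuous_rpow_const (y := (1 / 2 : ℝ))).tendsto _).comp h3
    refine (h7.congr fun k => ?_).trans (by simp)
    simp only [Function.comp_apply]
    rw [← ENNReal.rpow_natCast, ← ENNReal.rpow_mul]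
    simp only [Nat.cast_ofNat, one_div, ne_eq, OfNat.ofNat_ne_zero, not_false_eq_true,
      mul_inv_cancel₀, ENNReal.rpow_one]
    rfl
  simpa using h1.add h2

end Superposition

section ChainRule

open Filter Topology
open scoped NNReal

variable {n : ℕ} {Ω : Set (Sp n)} {β : ℝ → ℝ} {M : ℝ≥0}

lemma lipschitzWith_of_deriv_bound (hβ : ContDiff ℝ 1 β) (hM : ∀ s, |deriv β s| ≤ M) :
    LipschitzWith M β :=
  lipschitzWith_of_nnnorm_deriv_le (hβ.differentiable (by simp)) fun s => by
    rw [← NNReal.coe_le_coe]; exact hM s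

/-- The pair `(β(v), β'(v)∇v)`. -/
noncomputable def compPair (hβ : ContDiff ℝ 1 β) (h0 : β 0 = 0) (hM : ∀ s, |deriv β s| ≤ M)
    (v : H1 Ω) :
    WithLp 2 (Lp ℝ 2 (vol Ω) × Lp (Sp n) 2 (vol Ω)) :=
  WithLp.toLp 2 ((lipschitzWith_of_deriv_bound hβ hM).compLp h0 (val v),
    smulComp (hβ.continuous_deriv (by simp)) hM (val v) (grad v))

lemma continuous_compPair (hβ : ContDiff ℝ 1 β) (h0 : β 0 = 0) (hM : ∀ s, |deriv β s| ≤ M) :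
    Continuous (compPair (Ω := Ω) hβ h0 hM) := by
  refine (WithLp.prod_continuous_toLp 2 _ _).comp (Continuous.prodMk ?_ ?_)
  · exact ((lipschitzWith_of_deriv_bound hβ hM).continuous_compLp h0).comp continuous_val
  · exact (continuous_smulComp (hβ.continuous_deriv (by simp)) hM).comp
      (continuous_val.prodMk continuous_grad)

lemma gradient_comp (hβ : ContDiff ℝ 1 β) {F : Sp n → ℝ} (hF : ContDiff ℝ 1 F) (x : Sp n) :
    gradient (fun x => β (F x)) x = deriv β (F x) • gradient F x := by
  ext i
  have h := (((hβ.differentiable (by simp)) (F x)).hasDerivAt.comp_hasFDerivAt x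
    ((hF.differentiable (by simp)) x).hasFDerivAt).fderiv
  rw [PiLp.smul_apply, gradient_apply, gradient_apply]
  change fderiv ℝ (β ∘ F) x _ = _
  rw [h]
  simp

/-- For the restriction `v` of a `C¹` function, `(β(v), β'(v)∇v)` is again of this form. -/
lemma exists_compPair_eq (hb : Bornology.IsBounded Ω) (hβ : ContDiff ℝ 1 β) (h0 : β 0 = 0)
    (hM : ∀ s, |deriv β s| ≤ M) {v : H1 Ω} {F : Sp n → ℝ} (hF : ContDiff ℝ 1 F)
    (h1 : val v =ᵐ[vol Ω] F) (h2 : grad v =ᵐ[vol Ω] gradient F) :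
    ∃ w : H1 Ω, w.1 = compPair hβ h0 hM v ∧ val w =ᵐ[vol Ω] fun x => β (F x) := by
  obtain ⟨w, -, hw1, hw2⟩ := exists_mem_smoothH1 hb (hβ.comp hF)
  refine ⟨w, ?_, hw1⟩
  have e1 : val w = (lipschitzWith_of_deriv_bound hβ hM).compLp h0 (val v) := by
    refine Lp.ext ?_
    filter_upwards [hw1, (lipschitzWith_of_deriv_bound hβ hM).coeFn_compLp h0 (val v), h1]
      with x a1 a2 a3
    rw [a1, a2, Function.comp_apply, Function.comp_apply, a3]
  have e2 : grad w = smulComp (hβ.continuous_deriv (by simp)) hM (val v) (grad v) := by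
    refine Lp.ext ?_
    filter_upwards [hw2, coeFn_smulComp (hβ.continuous_deriv (by simp)) hM (val v) (grad v), h1, h2]
      with x a1 a2 a3 a4
    rw [a1, a2, a3, a4]
    exact gradient_comp hβ hF x
  have : w.1 = WithLp.toLp 2 (val w, grad w) := rfl
  rw [this, e1, e2, compPair]

/-- Chain rule in `H¹(Ω)`, by density of the restrictions of `C¹` functions. -/
lemma compPair_mem (hΩ : IsLipschitzDomain Ω) (hβ : ContDiff ℝ 1 β) (h0 : β 0 = 0)
    (hM : ∀ s, |deriv β s| ≤ M) (v : H1 Ω) : compPair hβ h0 hM v ∈ h1Submodule Ω := by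
  have hc : IsClosed {v : H1 Ω | compPair hβ h0 hM v ∈ h1Submodule Ω} :=
    isClosed_h1Submodule.preimage (continuous_compPair hβ h0 hM)
  have hsub : (smoothH1 Ω : Set (H1 Ω)) ⊆ {v : H1 Ω | compPair hβ h0 hM v ∈ h1Submodule Ω} := by
    rintro v ⟨F, hF, h1, h2⟩
    obtain ⟨w, hw, -⟩ := exists_compPair_eq hΩ.isBounded hβ h0 hM hF h1 h2
    rw [mem_ofPred_eq, ← hw]
    exact w.2
  have := hc.closure_subset_iff.2 hsub
  rw [hΩ.dense_smoothH1.closure_eq] at this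
  exact this (mem_univ v)

/-- The element `β(v)` of `H¹(Ω)`, for `v ∈ H¹(Ω)` and `β` of class `C¹` with bounded derivative
and `β(0) = 0`. -/
noncomputable def H1.comp (hΩ : IsLipschitzDomain Ω) (hβ : ContDiff ℝ 1 β) (h0 : β 0 = 0)
    (hM : ∀ s, |deriv β s| ≤ M) (v : H1 Ω) : H1 Ω :=
  ⟨compPair hβ h0 hM v, compPair_mem hΩ hβ h0 hM v⟩

variable (hΩ : IsLipschitzDomain Ω) (hβ : ContDiff ℝ 1 β) (h0 : β 0 = 0)
    (hM : ∀ s, |deriv β s| ≤ M)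

lemma H1.continuous_comp : Continuous (H1.comp hΩ hβ h0 hM) :=
  (continuous_compPair hβ h0 hM).subtype_mk _

lemma H1.val_comp (v : H1 Ω) : val (H1.comp hΩ hβ h0 hM v) =ᵐ[vol Ω] fun x => β (val v x) :=
  (lipschitzWith_of_deriv_bound hβ hM).coeFn_compLp h0 (val v)

lemma H1.grad_comp (v : H1 Ω) :
    grad (H1.comp hΩ hβ h0 hM v) =ᵐ[vol Ω] fun x => deriv β (val v x) • grad v x :=
  coeFn_smulComp (hβ.continuous_deriv (by simp)) hM _ _

lemma H1.norm_comp_le (v : H1 Ω) : ‖H1.comp hΩ hβ h0 hM v‖ ≤ 2 * M * ‖v‖ := by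
  have h1 : ‖val (H1.comp hΩ hβ h0 hM v)‖ ≤ M * ‖val v‖ :=
    (lipschitzWith_of_deriv_bound hβ hM).norm_compLp_le h0 (val v)
  have h2 : ‖grad (H1.comp hΩ hβ h0 hM v)‖ ≤ M * ‖grad v‖ :=
    norm_smulComp_le (hβ.continuous_deriv (by simp)) hM _ _
  have h3 := mul_le_mul_of_nonneg_left (norm_val_le v) M.2
  have h4 := mul_le_mul_of_nonneg_left (norm_grad_le v) M.2
  refine (H1.norm_le _).trans ?_
  simp only [NNReal.val_eq_coe] at h3 h4
  linarith

/-- The trace of `β(v)` is `β` of the trace of `v`. Both sides are continuous in `v ∈ H¹(Ω)` and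
agree for restrictions of `C¹` functions. -/
lemma trace_comp (v : H1 Ω) :
    trace Ω (H1.comp hΩ hβ h0 hM v) =ᵐ[surf Ω] fun x => β (trace Ω v x) := by
  have hL := lipschitzWith_of_deriv_bound hβ hM
  suffices h : trace Ω (H1.comp hΩ hβ h0 hM v) = hL.compLp h0 (trace Ω v) by
    rw [h]; exact hL.coeFn_compLp h0 (trace Ω v)
  unfold trace
  split_ifs with hS
  · have hS' := hS.choose_spec
    set S := hS.choose
    have hc : IsClosed {v : H1 Ω | S (H1.comp hΩ hβ h0 hM v) = hL.compLp h0 (S v)} :=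
      isClosed_eq (S.continuous.comp (H1.continuous_comp hΩ hβ h0 hM))
        ((hL.continuous_compLp h0).comp S.continuous)
    have hsub : (smoothH1 Ω : Set (H1 Ω)) ⊆
        {v : H1 Ω | S (H1.comp hΩ hβ h0 hM v) = hL.compLp h0 (S v)} := by
      rintro v ⟨F, hF, h1, h2⟩
      refine Lp.ext ?_
      filter_upwards [hS' v F hF.continuous.continuousOn h1, hL.coeFn_compLp h0 (S v),
        hS' (H1.comp hΩ hβ h0 hM v) (fun x => β (F x))
          (hβ.continuous.comp hF.continuous).continuousOn (by
            filter_upwards [H1.val_comp hΩ hβ h0 hM v, h1] with x a1 a2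
            rw [a1, a2])] with x a1 a2 a3
      rw [a2, a3, Function.comp_apply, a1]
    have := hc.closure_subset_iff.2 hsub
    rw [hΩ.dense_smoothH1.closure_eq] at this
    exact this (mem_univ v)
  -- If no trace operator exists, `trace Ω = 0`, and the claim is `β(0) = 0`.
  · exact (hL.compLp_zero h0).symm

end ChainRule

/-! ### Weak derivatives on an interval -/

section WeakDerivative

open Filter Topology
open scoped Interval

variable {T : ℝ}

lemma exists_Icc_of_isCompact_subset_Ioo (hT : 0 < T) {K : Set ℝ} (hK : IsCompact K)
    (hKT : K ⊆ Ioo 0 T) : ∃ a b, 0 < a ∧ b < T ∧ K ⊆ Icc a b := by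
  rcases K.eq_empty_or_nonempty with rfl | hne
  · exact ⟨T, 0, hT, hT, empty_subset _⟩
  · obtain ⟨a, ha, ha'⟩ := hK.exists_isLeast hne
    obtain ⟨b, hb, hb'⟩ := hK.exists_isGreatest hne
    exact ⟨a, b, (hKT ha).1, (hKT hb).2, fun x hx => ⟨ha' hx, hb' hx⟩⟩

/-- A test function on `]0,T[` with integral zero is the derivative of a test function. -/
lemma exists_test_deriv_eq (hT : 0 < T) {η : ℝ → ℝ} (hη : ContDiff ℝ ∞ η) (hs : HasCompactSupport η)
    (hsT : tsupport η ⊆ Ioo 0 T) (h0 : ∫ t, η t = 0) :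
    ∃ ψ : ℝ → ℝ, ContDiff ℝ ∞ ψ ∧ HasCompactSupport ψ ∧ tsupport ψ ⊆ Ioo 0 T ∧ deriv ψ = η := by
  obtain ⟨a, b, ha, hb, hab⟩ := exists_Icc_of_isCompact_subset_Ioo hT hs hsT
  have hd : ∀ t, HasDerivAt (fun t => ∫ s in (0 : ℝ)..t, η s) (η t) t := fun t =>
    intervalIntegral.integral_hasDerivAt_right (hη.continuous.intervalIntegrable _ _)
      hη.continuous.stronglyMeasurable.stronglyMeasurableAtFilter hη.continuous.continuousAt
  have hderiv : deriv (fun t => ∫ s in (0 : ℝ)..t, η s) = η := funext fun t => (hd t).deriv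
  have hz : ∀ t, t ∉ Icc a b → η t = 0 := fun t ht =>
    image_eq_zero_of_notMem_tsupport fun h => ht (hab h)
  have hsupp : ∀ t, t ∉ Icc a b → ∫ s in (0 : ℝ)..t, η s = 0 := by
    intro t ht
    rw [mem_Icc, not_and_or, not_le, not_le] at ht
    rcases ht with ht | ht
    · refine intervalIntegral.integral_zero_ae (Eventually.of_forall fun s hs => hz s ?_)
      rintro ⟨h1, -⟩
      have := (mem_uIoc.1 hs)
      rcases this with h | h <;> linarith [h.1, h.2]
    · -- To the right of the support the primitive is the whole integral.
      rcases le_or_gt a t with hat | hat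
      · have h0t : (0 : ℝ) ≤ t := by linarith
        rw [intervalIntegral.integral_of_le h0t, setIntegral_eq_integral_of_forall_compl_eq_zero,
          h0]
        intro s hs
        refine hz s fun h => hs ⟨by linarith [h.1], by linarith [h.2]⟩
      · refine intervalIntegral.integral_zero_ae (Eventually.of_forall fun s hs => hz s ?_)
        rintro ⟨h1, h2⟩
        linarith
  have hts : tsupport (fun t => ∫ s in (0 : ℝ)..t, η s) ⊆ Icc a b :=
    closure_minimal (fun t ht => by by_contra h; exact ht (hsupp t h)) isClosed_Icc
  refine ⟨fun t => ∫ s in (0 : ℝ)..t, η s, ?_, ?_, hts.trans fun t ht => ?_, hderiv⟩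
  · rw [contDiff_infty_iff_deriv, hderiv]
    exact ⟨fun t => (hd t).differentiableAt, hη⟩
  · exact HasCompactSupport.of_support_subset_isCompact isCompact_Icc
      ((subset_tsupport _).trans hts)
  · exact ⟨ha.trans_le ht.1, ht.2.trans_lt hb⟩

/-- The lemma of du Bois-Reymond: a continuous function with vanishing distributional derivative
is constant. -/
lemma eq_of_integral_deriv_mul_eq_zero (hT : 0 < T) {k : ℝ → ℝ} (hk : ContinuousOn k (Icc 0 T))
    (h : ∀ ψ : ℝ → ℝ, ContDiff ℝ ∞ ψ → HasCompactSupport ψ → tsupport ψ ⊆ Ioo 0 T →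
      ∫ t in Ioo 0 T, deriv ψ t * k t = 0) : ∀ t ∈ Icc 0 T, k t = k 0 := by
  let b : ContDiffBump (T / 2) := ⟨T / 8, T / 4, by positivity, by linarith⟩
  set η₀ := b.normed volume with hη₀
  have hη₀c : ContDiff ℝ ∞ η₀ := b.contDiff_normed (n := ⊤)
  have hη₀s : HasCompactSupport η₀ := b.hasCompactSupport_normed
  have hη₀T : tsupport η₀ ⊆ Ioo 0 T := by
    rw [hη₀, b.tsupport_normed_eq, Real.closedBall_eq_Icc]
    change Icc (T / 2 - T / 4) (T / 2 + T / 4) ⊆ _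
    exact fun t ht => ⟨by linarith [ht.1], by linarith [ht.2]⟩
  have hη₀1 : ∫ t, η₀ t = 1 := b.integral_normed
  have hmul : ∀ φ : ℝ → ℝ, Continuous φ → IntegrableOn (fun t => φ t * k t) (Ioo 0 T) :=
    fun φ hφ => ((hφ.continuousOn.mul hk).integrableOn_Icc).mono_set Ioo_subset_Icc_self
  set c := ∫ t in Ioo 0 T, η₀ t * k t with hc
  have hae : ∀ᵐ t, t ∈ Ioo 0 T → k t - c = 0 := by
    refine isOpen_Ioo.ae_eq_zero_of_integral_contDiff_smul_eq_zero ?_ fun η hη hs hsT => ?_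
    · exact ((hk.mono Ioo_subset_Icc_self).sub continuousOn_const).locallyIntegrableOn
        measurableSet_Ioo
    have hint : ∫ t, (η t - (∫ s, η s) * η₀ t) = 0 := by
      rw [integral_sub (hη.continuous.integrable_of_hasCompactSupport hs)
        ((hη₀c.continuous.integrable_of_hasCompactSupport hη₀s).const_mul _), integral_const_mul,
        hη₀1, mul_one, sub_self]
    have hsupp : tsupport (fun t => η t - (∫ s, η s) * η₀ t) ⊆ Ioo 0 T :=
      (tsupport_sub η _).trans
        (union_subset hsT ((tsupport_mul_subset_right (f := fun _ => ∫ s, η s)).trans hη₀T))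
    obtain ⟨ψ, h1, h2, h3, h4⟩ := exists_test_deriv_eq hT
      (hη.sub (contDiff_const.mul hη₀c)) (hs.sub hη₀s.mul_left) hsupp hint
    have h5 := h ψ h1 h2 h3
    rw [h4] at h5
    have h6 : ∫ t in Ioo 0 T, (η t - (∫ s, η s) * η₀ t) * k t =
        (∫ t in Ioo 0 T, η t * k t) - (∫ s, η s) * c := by
      rw [hc, ← integral_const_mul, ← integral_sub (hmul η hη.continuous)
        ((hmul η₀ hη₀c.continuous).const_mul _)]
      refine integral_congr_ae (Eventually.of_forall fun t => ?_)
      simp only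
      ring
    rw [h6] at h5
    have hz : ∀ t, t ∉ Ioo 0 T → η t = 0 := fun t ht =>
      image_eq_zero_of_notMem_tsupport fun h => ht (hsT h)
    have h7 : ∫ s, η s = ∫ s in Ioo 0 T, η s :=
      (setIntegral_eq_integral_of_forall_compl_eq_zero hz).symm
    rw [← setIntegral_eq_integral_of_forall_compl_eq_zero (s := Ioo 0 T)
      (fun t ht => by simp [hz t ht])]
    have h8 : ∫ t in Ioo 0 T, η t • (k t - c) =
        (∫ t in Ioo 0 T, η t * k t) - (∫ s, η s) * c := by
      rw [h7, ← integral_mul_const, ← integral_sub (hmul η hη.continuous)]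
      · refine integral_congr_ae (Eventually.of_forall fun t => ?_)
        simp only [smul_eq_mul]
        ring
      · exact ((hη.continuous.integrable_of_hasCompactSupport hs).integrableOn).mul_const _
    rw [h8, h5]
  have hae' : k =ᵐ[volume.restrict (Icc 0 T)] fun _ => c := by
    rw [← restrict_Ioo_eq_restrict_Icc]
    rw [EventuallyEq, ae_restrict_iff' measurableSet_Ioo]
    filter_upwards [hae] with t ht h
    linarith [ht h]
  have hEq := Measure.eqOn_Icc_of_ae_eq volume hT.ne hae' hk continuousOn_const
  intro t ht
  rw [hEq ht, hEq ⟨le_rfl, hT.le⟩]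

/-- A continuous function whose distributional derivative is integrable is a primitive of it. -/
lemma sub_eq_integral_of_weak_derivative (hT : 0 < T) {f g : ℝ → ℝ} (hf : ContinuousOn f (Icc 0 T))
    (hg : IntegrableOn g (Ioo 0 T))
    (h : ∀ ψ : ℝ → ℝ, ContDiff ℝ ∞ ψ → HasCompactSupport ψ → tsupport ψ ⊆ Ioo 0 T →
      ∫ t in Ioo 0 T, ψ t * g t = - ∫ t in Ioo 0 T, deriv ψ t * f t) :
    ∀ t ∈ Icc 0 T, f t - f 0 = ∫ s in (0 : ℝ)..t, g s := by
  have hgi : IntervalIntegrable g volume 0 T :=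
    (intervalIntegrable_iff_integrableOn_Ioo_of_le hT.le).2 hg
  set P := fun t => ∫ s in (0 : ℝ)..t, g s with hP
  have hPac : AbsolutelyContinuousOnInterval P 0 T :=
    hgi.absolutelyContinuousOnInterval_intervalIntegral (c := 0) (by simp)
  have hPc : ContinuousOn P (Icc 0 T) := by
    have := hPac.continuousOn
    rwa [uIcc_of_le hT.le] at this
  have key := eq_of_integral_deriv_mul_eq_zero hT (hf.sub hPc) (fun ψ h1 h2 h3 => by
    have hψ' : Continuous (deriv ψ) := h1.continuous_deriv (by simp)
    have hmul : ∀ F : ℝ → ℝ, ContinuousOn F (Icc 0 T) →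
        IntegrableOn (fun t => deriv ψ t * F t) (Ioo 0 T) := fun F hF =>
      ((hψ'.continuousOn.mul hF).integrableOn_Icc).mono_set Ioo_subset_Icc_self
    have e1 : ∫ t in Ioo 0 T, deriv ψ t * (f t - P t) =
        (∫ t in Ioo 0 T, deriv ψ t * f t) - ∫ t in Ioo 0 T, deriv ψ t * P t := by
      rw [← integral_sub (hmul f hf) (hmul P hPc)]
      simp only [mul_sub]
    have hψac : AbsolutelyContinuousOnInterval ψ 0 T :=
      ContDiffOn.absolutelyContinuousOnInterval (h1.of_le (by exact_mod_cast le_top)).contDiffOn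
    have hz : ∀ t, t ∉ Ioo 0 T → ψ t = 0 := fun t ht =>
      image_eq_zero_of_notMem_tsupport fun h => ht (h3 h)
    have e2 := hPac.integral_mul_deriv_eq_deriv_mul hψac
    rw [hz T (by simp), hz 0 (by simp), mul_zero, mul_zero, sub_zero, zero_sub] at e2
    have e3 : ∫ t in (0 : ℝ)..T, deriv P t * ψ t = ∫ t in (0 : ℝ)..T, ψ t * g t := by
      refine intervalIntegral.integral_congr_ae ?_
      filter_upwards [hgi.ae_hasDerivAt_integral] with t ht htT
      rw [(ht (uIoc_subset_uIcc htT) 0 (by simp)).deriv, mul_comm]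
    rw [e3, intervalIntegral.integral_of_le hT.le, intervalIntegral.integral_of_le hT.le,
      integral_Ioc_eq_integral_Ioo, integral_Ioc_eq_integral_Ioo, h ψ h1 h2 h3] at e2
    simp only [mul_comm (P _)] at e2
    change ∫ t in Ioo 0 T, deriv ψ t * (f t - P t) = 0
    rw [e1, e2]
    ring)
  intro t ht
  have := key t ht
  simp only [Pi.sub_apply] at this
  have hP0 : P 0 = 0 := by simp [hP]
  rw [hP0] at this
  change f t - f 0 = P t
  linarith

end WeakDerivative

/-! ### Steklov averages -/

section Steklov

open Filter Topology
open scoped Interval NNReal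

/-- The Cauchy-Schwarz inequality for the duality pairing of `L²(ν; V')` and `L²(ν; V)`. -/
lemma integrable_apply_and_norm_integral_le {α V : Type*} [MeasurableSpace α] {ν : Measure α}
    [NormedAddCommGroup V] [NormedSpace ℝ V] {L : α → V →L[ℝ] ℝ} {v : α → V} (hL : MemLp L 2 ν)
    (hv : MemLp v 2 ν) : Integrable (fun x => L x (v x)) ν ∧
      |∫ x, L x (v x) ∂ν| ≤ (eLpNorm L 2 ν * eLpNorm v 2 ν).toReal := by
  have hb : ∀ᵐ x ∂ν, ‖L x (v x)‖₊ ≤ 1 * ‖L x‖₊ * ‖v x‖₊ :=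
    Eventually.of_forall fun x => by rw [one_mul]; exact (L x).le_opNNNorm _
  have hm : AEStronglyMeasurable (fun x => L x (v x)) ν :=
    (ContinuousLinearMap.id ℝ (V →L[ℝ] ℝ)).aestronglyMeasurable_comp₂ hL.1 hv.1
  have h1 : MemLp (fun x => L x (v x)) 1 ν :=
    MemLp.of_bilin (fun (L : V →L[ℝ] ℝ) v => L v) 1 hL hv hm hb
  have h2 := eLpNorm_le_eLpNorm_mul_eLpNorm_of_nnnorm (p := 2) (q := 2) (r := 1) hL.1 hv.1
    (fun (L : V →L[ℝ] ℝ) v => L v) 1 hb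
  refine ⟨memLp_one_iff_integrable.1 h1, ?_⟩
  rw [← Real.norm_eq_abs, ← toReal_enorm]
  refine ENNReal.toReal_mono (ENNReal.mul_ne_top hL.2.ne hv.2.ne) ?_
  refine (enorm_integral_le_lintegral_enorm _).trans ?_
  rw [← eLpNorm_one_eq_lintegral_enorm]
  simpa using h2

/-- The uniform distribution on `]0,h]`. -/
noncomputable def uniformMeasure (h : ℝ) : Measure ℝ :=
  ENNReal.ofReal h⁻¹ • volume.restrict (Ioc 0 h)

lemma isProbabilityMeasure_uniformMeasure {h : ℝ} (hh : 0 < h) :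
    IsProbabilityMeasure (uniformMeasure h) := by
  refine ⟨?_⟩
  rw [uniformMeasure, Measure.smul_apply, Measure.restrict_apply_univ, Real.volume_Ioc, sub_zero,
    smul_eq_mul, ← ENNReal.ofReal_mul (by positivity), inv_mul_cancel₀ hh.ne', ENNReal.ofReal_one]

lemma ae_norm_lt_uniformMeasure {h δ : ℝ} (hδ : h < δ) :
    ∀ᵐ z ∂(uniformMeasure h), ‖z‖ < δ := by
  refine Measure.ae_smul_measure ?_ _
  refine (ae_restrict_mem measurableSet_Ioc).mono fun z hz => ?_
  rw [Real.norm_of_nonneg hz.1.le]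
  exact hz.2.trans_lt hδ

/-- The mean value of the translates `f(t - ·)` over `]0,h]` is the Steklov average of `f`. -/
lemma integral_uniformMeasure {F : Type*} [NormedAddCommGroup F] [NormedSpace ℝ F] {h : ℝ}
    (hh : 0 < h) (f : ℝ → F) (t : ℝ) :
    ∫ z, f (t - z) ∂(uniformMeasure h) = h⁻¹ • ∫ s in (t - h)..t, f s := by
  rw [uniformMeasure, integral_smul_measure, ← intervalIntegral.integral_of_le hh.le,
    intervalIntegral.integral_comp_sub_left, sub_zero, ENNReal.toReal_ofReal (by positivity)]

lemma continuous_integral_uniformMeasure {F : Type*} [NormedAddCommGroup F]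
    [NormedSpace ℝ F] {h : ℝ}
    (hh : 0 < h) {f : ℝ → F} (hf : Integrable f volume) :
    Continuous fun t => ∫ z, f (t - z) ∂(uniformMeasure h) := by
  have e : (fun t => ∫ z, f (t - z) ∂(uniformMeasure h)) =
      fun t => h⁻¹ • ((∫ s in (0 : ℝ)..t, f s) - ∫ s in (0 : ℝ)..(t - h), f s) := by
    ext1 t
    rw [integral_uniformMeasure hh, intervalIntegral.integral_interval_sub_left
      hf.intervalIntegrable hf.intervalIntegrable]
  rw [e]
  have h1 := hf.continuous_primitive 0
  exact (h1.sub (h1.comp (continuous_id.sub continuous_const))).const_smul _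

/-- A nonnegative function on `]-∞,T]` that vanishes for `t ≤ 0` satisfies
`h ∫₀ᵃ μ(t) dt ≤ ∫₀ᵀ (T - t)(μ(t) - μ(t - h)) dt` when `a + h ≤ T`: a discrete integration by
parts against the weight `T - t`. -/
lemma mul_integral_le_integral_weight_mul_sub {T a h : ℝ} (ha : 0 ≤ a) (hh : 0 < h)
    (hah : a + h ≤ T)
    {μ : ℝ → ℝ} (hμ : ContinuousOn μ (Iic T)) (hμ0 : ∀ t ≤ 0, μ t = 0) (hμn : ∀ t, 0 ≤ μ t) :
    h * ∫ t in (0 : ℝ)..a, μ t ≤ ∫ t in (0 : ℝ)..T, (T - t) * (μ t - μ (t - h)) := by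
  have hi : ∀ {φ : ℝ → ℝ} {c d : ℝ}, Continuous φ → c ≤ T → d ≤ T →
      IntervalIntegrable (fun t => φ t * μ t) volume c d := fun {φ c d} hφ hc hd =>
    (hφ.continuousOn.mul (hμ.mono fun x hx => by
      rcases mem_uIcc.1 hx with h | h <;> exact h.2.trans ‹_›)).intervalIntegrable
  have hT : 0 < T := by linarith
  have hshift : ∫ t in (0 : ℝ)..T, (T - t) * μ (t - h) =
      ∫ t in (0 : ℝ)..(T - h), (T - h - t) * μ t := by
    have e1 : ∫ t in (0 : ℝ)..T, (T - t) * μ (t - h) =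
        ∫ t in (0 - h)..(T - h), (T - h - t) * μ t := by
      rw [← intervalIntegral.integral_comp_sub_right (fun t => (T - h - t) * μ t)]
      refine intervalIntegral.integral_congr fun t _ => ?_
      ring
    have e2 : ∫ t in (0 - h)..(0 : ℝ), (T - h - t) * μ t = 0 := by
      refine intervalIntegral.integral_zero_ae (Eventually.of_forall fun t ht => ?_)
      rw [uIoc_of_le (by linarith)] at ht
      rw [hμ0 t ht.2, mul_zero]
    rw [e1, ← intervalIntegral.integral_add_adjacent_intervals (b := 0)
      (hi (by fun_prop) (by linarith) (by linarith)) (hi (by fun_prop) (by linarith) (by linarith)),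
      e2, zero_add]
  have hshi : IntervalIntegrable (fun t => (T - t) * μ (t - h)) volume 0 T := by
    refine ContinuousOn.intervalIntegrable ?_
    refine (by fun_prop : Continuous fun t : ℝ => T - t).continuousOn.mul
      (hμ.comp (by fun_prop) fun t ht => ?_)
    rw [uIcc_of_le hT.le] at ht
    exact mem_Iic.2 (by linarith [ht.2])
  have e3 : ∫ t in (0 : ℝ)..T, (T - t) * (μ t - μ (t - h)) =
      (∫ t in (0 : ℝ)..T, (T - t) * μ t) - ∫ t in (0 : ℝ)..T, (T - t) * μ (t - h) := by
    rw [← intervalIntegral.integral_sub (hi (by fun_prop) hT.le le_rfl) hshi]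
    simp only [mul_sub]
  have e4 : ∫ t in (0 : ℝ)..T, (T - t) * μ t =
      (∫ t in (0 : ℝ)..(T - h), (T - t) * μ t) + ∫ t in (T - h)..T, (T - t) * μ t :=
    (intervalIntegral.integral_add_adjacent_intervals
      (hi (by fun_prop) (by linarith) (by linarith))
      (hi (by fun_prop) (by linarith) (by linarith))).symm
  have e5 : 0 ≤ ∫ t in (T - h)..T, (T - t) * μ t :=
    intervalIntegral.integral_nonneg (by linarith) fun t ht =>
      mul_nonneg (by linarith [ht.2]) (hμn t)
  have e6 : (∫ t in (0 : ℝ)..(T - h), (T - t) * μ t) -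
      (∫ t in (0 : ℝ)..(T - h), (T - h - t) * μ t) = ∫ t in (0 : ℝ)..(T - h), h * μ t := by
    rw [← intervalIntegral.integral_sub (hi (by fun_prop) (by linarith) (by linarith))
      (hi (by fun_prop) (by linarith) (by linarith))]
    refine intervalIntegral.integral_congr fun t _ => ?_
    ring
  have e7 : ∫ t in (0 : ℝ)..a, h * μ t ≤ ∫ t in (0 : ℝ)..(T - h), h * μ t := by
    refine intervalIntegral.integral_mono_interval le_rfl ha (by linarith) ?_
      (hi (φ := fun _ => h) continuous_const (by linarith) (by linarith))
    exact Eventually.of_forall fun t => mul_nonneg hh.le (hμn t)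
  rw [intervalIntegral.integral_const_mul] at e7
  rw [e3, hshift, e4]
  linarith

/-- The extension by zero of a function on `]0,T[`, with a strongly measurable representative. -/
lemma exists_extension_by_zero {F : Type*} [NormedAddCommGroup F] {T : ℝ} {f : ℝ → F}
    (hf : MemLp f 2 (timeMeasure T)) : ∃ g : ℝ → F, StronglyMeasurable g ∧ MemLp g 2 volume ∧
      Integrable g volume ∧ g =ᵐ[timeMeasure T] f ∧ ∀ t ∉ Ioo 0 T, g t = 0 := by
  have hmk : MemLp (hf.1.mk f) 2 (timeMeasure T) := hf.ae_eq hf.1.ae_eq_mk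
  refine ⟨(Ioo 0 T).indicator (hf.1.mk f),
    hf.1.stronglyMeasurable_mk.indicator measurableSet_Ioo,
    (memLp_indicator_iff_restrict measurableSet_Ioo).2 hmk,
    (integrable_indicator_iff measurableSet_Ioo).2 (hmk.integrable (by simp)), ?_,
    fun t ht => indicator_of_notMem ht _⟩
  filter_upwards [hf.1.ae_eq_mk, ae_restrict_mem measurableSet_Ioo] with t h1 h2
  rw [indicator_of_mem h2, h1]

lemma memLp_weight_smul {V : Type*} [NormedAddCommGroup V] [NormedSpace ℝ V] (hT : 0 < T)
    {w : ℝ → V} (hw : MemLp w 2 (timeMeasure T)) :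
    MemLp (fun t => (T - t) • w t) 2 (timeMeasure T) := by
  refine (hw.const_smul T).of_le
    ((by fun_prop : Continuous fun t : ℝ => T - t).aestronglyMeasurable.smul hw.1) ?_
  filter_upwards [ae_restrict_mem measurableSet_Ioo] with t ht
  rw [Pi.smul_apply, norm_smul, norm_smul]
  refine mul_le_mul_of_nonneg_right ?_ (norm_nonneg _)
  rw [Real.norm_of_nonneg (by linarith [ht.2]), Real.norm_of_nonneg hT.le]
  linarith [ht.1]

/-- Let `U ∈ C([0,T]; H)` have the derivative `u' ∈ L²(0,T; V')`, where `ι : V → H`, and let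
`ι(w(t))` be a subgradient of `m ≥ 0` at `U(t)`, where `m(U(0)) = 0`. Then
`∫₀ᵃ m(U(t)) dt ≤ ∫₀ᵀ (T - t) ⟨u'(t), w(t)⟩ dt` for `a < T`. In the inequality for the difference
quotients of `U` the Steklov averages of `u'` appear, which converge to `u'` in `L²(0,T; V')`. -/
lemma integral_le_integral_weight_mul_apply {H V : Type*} [NormedAddCommGroup H]
    [InnerProductSpace ℝ H] [NormedAddCommGroup V] [NormedSpace ℝ V] {T a : ℝ} (ha : 0 ≤ a)
    (haT : a < T) {U : ℝ → H} (hU : ContinuousOn U (Icc 0 T)) {u' : ℝ → V →L[ℝ] ℝ}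
    (hu' : MemLp u' 2 (timeMeasure T)) {ι : V → H}
    (hftc : ∀ t ∈ Icc 0 T, ∀ w, inner ℝ (U t) (ι w) - inner ℝ (U 0) (ι w) =
      ∫ s in (0 : ℝ)..t, u' s w)
    {m : H → ℝ} (hm : Continuous m) (hm0 : ∀ y, 0 ≤ m y) (hmU : m (U 0) = 0) {w : ℝ → V}
    (hw : MemLp w 2 (timeMeasure T))
    (hsub : ∀ᵐ t ∂(timeMeasure T), ∀ y, m (U t) - m y ≤ inner ℝ (U t - y) (ι (w t))) :
    ∫ t in (0 : ℝ)..a, m (U t) ≤ ∫ t in Ioo 0 T, u' t ((T - t) • w t) := by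
  have hT : 0 < T := ha.trans_lt haT
  -- The extensions by `U(0)` and by `0` to negative times.
  set Ũ : ℝ → H := fun t => U (max t 0) with hŨ
  have hŨc : ContinuousOn Ũ (Iic T) :=
    hU.comp (by fun_prop) fun t ht => ⟨le_max_right _ _, max_le ht hT.le⟩
  obtain ⟨g, hgm, hg2, hgI, hgu, hg0⟩ := exists_extension_by_zero hu'
  have hgv : ∀ v, Integrable (fun s => g s v) volume := fun v =>
    (ContinuousLinearMap.apply ℝ ℝ v).integrable_comp hgI
  have hprim : ∀ t ≤ T, ∀ v, inner ℝ (Ũ t) (ι v) - inner ℝ (U 0) (ι v) =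
      ∫ s in (0 : ℝ)..t, g s v := by
    intro t ht v
    rcases le_total 0 t with h0 | h0
    · rw [hŨ]
      simp only [max_eq_left h0]
      rw [hftc t ⟨h0, ht⟩, intervalIntegral.integral_of_le h0, intervalIntegral.integral_of_le h0,
        integral_Ioc_eq_integral_Ioo, integral_Ioc_eq_integral_Ioo]
      refine integral_congr_ae ?_
      filter_upwards [ae_mono (Measure.restrict_mono (Ioo_subset_Ioo_right ht) le_rfl) hgu]
        with s hs
      rw [hs]
    · rw [hŨ]
      simp only [max_eq_right h0, sub_self]
      refine (intervalIntegral.integral_zero_ae (Eventually.of_forall fun s hs => ?_)).symm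
      rw [uIoc_of_ge h0] at hs
      rw [hg0 s fun h => by linarith [h.1, hs.2], zero_apply]
  -- The Steklov averages of `g`.
  set S : ℝ → ℝ → V →L[ℝ] ℝ := fun h t => ∫ z, g (t - z) ∂(uniformMeasure h) with hS
  have hSeq : ∀ {h}, 0 < h → ∀ t, S h t = h⁻¹ • ∫ s in (t - h)..t, g s := fun hh t =>
    integral_uniformMeasure hh g t
  have hSc : ∀ {h}, 0 < h → Continuous (S h) := fun hh =>
    continuous_integral_uniformMeasure hh hgI
  have hSpair : ∀ {h}, 0 < h → ∀ t ≤ T, ∀ v,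
      h * S h t v = inner ℝ (Ũ t - Ũ (t - h)) (ι v) := by
    intro h hh t ht v
    rw [hSeq hh, smul_apply, smul_eq_mul, ← mul_assoc, mul_inv_cancel₀ hh.ne',
      one_mul, inner_sub_left]
    have e1 : (∫ s in (t - h)..t, g s) v = ∫ s in (t - h)..t, g s v :=
      ((ContinuousLinearMap.apply ℝ ℝ v).intervalIntegral_comp_comm
        hgI.intervalIntegrable).symm
    rw [e1, ← intervalIntegral.integral_interval_sub_left (hgv v).intervalIntegrable
      (hgv v).intervalIntegrable, ← hprim t ht v, ← hprim (t - h) (by linarith) v]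
    ring
  set v : ℝ → V := fun t => (T - t) • w t with hv
  have hv2 : MemLp v 2 (timeMeasure T) := memLp_weight_smul hT hw
  -- The inequality for the difference quotients.
  have hstep : ∀ h, 0 < h → a + h ≤ T →
      Integrable (fun t => S h t (v t)) (timeMeasure T) →
      ∫ t in (0 : ℝ)..a, m (U t) ≤ ∫ t in Ioo 0 T, S h t (v t) := by
    intro h hh hah hint
    have hμc : ContinuousOn (fun t => m (Ũ t)) (Iic T) := hm.comp_continuousOn hŨc
    have h1 := mul_integral_le_integral_weight_mul_sub ha hh hah hμc
      (fun t ht => by simp only [hŨ, max_eq_right ht, hmU]) fun t => hm0 _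
    have h2 : ∫ t in (0 : ℝ)..a, m (Ũ t) = ∫ t in (0 : ℝ)..a, m (U t) := by
      refine intervalIntegral.integral_congr fun t ht => ?_
      rw [uIcc_of_le ha] at ht
      simp only [hŨ, max_eq_left ht.1]
    rw [h2, intervalIntegral.integral_of_le hT.le, integral_Ioc_eq_integral_Ioo] at h1
    have h3 : ∫ t in Ioo 0 T, (T - t) * (m (Ũ t) - m (Ũ (t - h))) ≤
        ∫ t in Ioo 0 T, h * S h t (v t) := by
      refine integral_mono_ae ?_ (hint.const_mul h) ?_
      · refine (ContinuousOn.integrableOn_Icc ?_).mono_set Ioo_subset_Icc_self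
        refine (by fun_prop : Continuous fun t : ℝ => T - t).continuousOn.mul
          ((hμc.mono Icc_subset_Iic_self).sub (hμc.comp (by fun_prop) fun t ht => ?_))
        exact mem_Iic.2 (by linarith [ht.2])
      · filter_upwards [hsub, ae_restrict_mem measurableSet_Ioo] with t ht htT
        have e : Ũ t = U t := by simp only [hŨ, max_eq_left htT.1.le]
        rw [hv]
        simp only [map_smul, smul_eq_mul]
        have h4 := hSpair hh t htT.2.le (w t)
        have h5 := ht (Ũ (t - h))
        rw [← e] at h5
        have h6 := mul_le_mul_of_nonneg_left h5 (by linarith [htT.2] : 0 ≤ T - t)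
        calc (T - t) * (m (Ũ t) - m (Ũ (t - h))) ≤ (T - t) * (h * S h t (w t)) := by rwa [h4]
          _ = h * ((T - t) * S h t (w t)) := by ring
    rw [integral_const_mul] at h3
    exact le_of_mul_le_mul_left (h1.trans h3) hh
  have hguv : ∫ t in Ioo 0 T, u' t (v t) = ∫ t in Ioo 0 T, g t (v t) := by
    refine integral_congr_ae ?_
    filter_upwards [hgu] with t ht
    rw [ht]
  change _ ≤ ∫ t in Ioo 0 T, u' t (v t)
  rw [hguv]
  refine le_of_forall_pos_le_add fun ε hε => ?_
  -- The averages are close to `g`; the factor accounts for the norm of `v`.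
  set N := (eLpNorm v 2 (timeMeasure T)).toReal with hN
  have hN0 : 0 ≤ N := ENNReal.toReal_nonneg
  obtain ⟨δ, hδ, hclose⟩ := exists_eLpNorm_average_translate_sub_le hgm hg2
    (ENNReal.ofReal_pos.2 (by positivity : 0 < ε / (N + 1)))
  obtain ⟨h, hh, hhδ, hha⟩ : ∃ h, 0 < h ∧ h < δ ∧ a + h ≤ T := by
    refine ⟨min (δ / 2) (T - a), lt_min (by positivity) (by linarith), ?_, ?_⟩
    · exact (min_le_left _ _).trans_lt (by linarith)
    · linarith [min_le_right (δ / 2) (T - a)]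
  have hd := hclose (uniformMeasure h) (isProbabilityMeasure_uniformMeasure hh)
    (ae_norm_lt_uniformMeasure hhδ)
  have hd' : eLpNorm (fun t => S h t - g t) 2 (timeMeasure T) ≤ ENNReal.ofReal (ε / (N + 1)) :=
    (eLpNorm_mono_measure _ Measure.restrict_le_self).trans hd
  have hdm : MemLp (fun t => S h t - g t) 2 (timeMeasure T) :=
    ⟨(hSc hh).aestronglyMeasurable.sub hgm.aestronglyMeasurable, hd'.trans_lt ENNReal.ofReal_lt_top⟩
  obtain ⟨i1, b1⟩ := integrable_apply_and_norm_integral_le hdm hv2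
  obtain ⟨i2, -⟩ := integrable_apply_and_norm_integral_le
    (hg2.mono_measure Measure.restrict_le_self : MemLp g 2 (timeMeasure T)) hv2
  have hsum : ∀ t, S h t (v t) = (S h t - g t) (v t) + g t (v t) := fun t => by simp
  have hi : Integrable (fun t => S h t (v t)) (timeMeasure T) := by
    simp only [hsum]
    exact i1.add i2
  refine (hstep h hh hha hi).trans ?_
  have e1 : ∫ t in Ioo 0 T, S h t (v t) =
      (∫ t in Ioo 0 T, (S h t - g t) (v t)) + ∫ t in Ioo 0 T, g t (v t) := by
    rw [← integral_add i1 i2]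
    simp only [hsum]
  have e2 : (eLpNorm (fun t => S h t - g t) 2 (timeMeasure T) *
      eLpNorm v 2 (timeMeasure T)).toReal ≤ ε := by
    rw [ENNReal.toReal_mul]
    calc _ ≤ ε / (N + 1) * N := by
          refine mul_le_mul_of_nonneg_right ?_ hN0
          exact ENNReal.toReal_le_of_le_ofReal (by positivity) hd'
      _ ≤ ε := by
          rw [div_mul_eq_mul_div, div_le_iff₀ (by positivity)]
          nlinarith
  have e3 := (abs_le.1 b1).2
  rw [e1]
  linarith

end Steklov

/-! ### The cut-off functions -/

section NegPart

open Filter Topology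
open scoped NNReal

/-- The square of the negative part, a function of class `C¹`. -/
noncomputable def negPartSq (s : ℝ) : ℝ := (max (-s) 0) ^ 2

lemma negPartSq_nonneg (s : ℝ) : 0 ≤ negPartSq s := sq_nonneg _

lemma negPartSq_of_nonneg {s : ℝ} (hs : 0 ≤ s) : negPartSq s = 0 := by
  rw [negPartSq, max_eq_right (by linarith)]; simp

lemma negPartSq_pos {s : ℝ} (hs : s < 0) : 0 < negPartSq s := by
  rw [negPartSq, max_eq_left (by linarith)]; nlinarith

lemma hasDerivAt_negPartSq (s : ℝ) : HasDerivAt negPartSq (-(2 * max (-s) 0)) s := by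
  rcases lt_trichotomy s 0 with hs | rfl | hs
  · have h1 : HasDerivAt (fun t : ℝ => t ^ 2) (2 * s) s := by simpa using hasDerivAt_pow 2 s
    rw [max_eq_left (by linarith)]
    refine (h1.congr_of_eventuallyEq ?_).congr_deriv (by ring)
    filter_upwards [Iio_mem_nhds hs] with t ht
    rw [negPartSq, max_eq_left (by linarith [mem_Iio.1 ht]), neg_sq]
  · have h0 : negPartSq 0 = 0 := negPartSq_of_nonneg le_rfl
    have h1 : HasDerivAt (fun t : ℝ => t ^ 2) 0 0 := by simpa using hasDerivAt_pow 2 (0 : ℝ)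
    rw [hasDerivAt_iff_isLittleO] at h1 ⊢
    simp only [neg_zero, max_self, mul_zero, smul_zero, sub_zero, h0] at h1 ⊢
    refine (Asymptotics.isBigO_of_le (g := fun t : ℝ => t ^ 2) _ fun t => ?_).trans_isLittleO
      (by simpa using h1)
    rw [Real.norm_of_nonneg (negPartSq_nonneg t), Real.norm_of_nonneg (sq_nonneg t), negPartSq,
      ← sq_abs t]
    exact pow_le_pow_left₀ (le_max_right _ _) (max_le (neg_le_abs t) (abs_nonneg t)) 2
  · rw [max_eq_right (by linarith)]
    refine ((hasDerivAt_const s (0 : ℝ)).congr_of_eventuallyEq ?_).congr_deriv (by simp)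
    filter_upwards [Ioi_mem_nhds hs] with t ht
    exact negPartSq_of_nonneg (le_of_lt ht)

/-- The approximation `-(s⁻)² / (ε + (s⁻)²)` of minus the indicator function of `s < 0`. -/
noncomputable def cutoff (ε s : ℝ) : ℝ := -(negPartSq s / (ε + negPartSq s))

variable {ε : ℝ}

lemma hasDerivAt_cutoff (hε : 0 < ε) (s : ℝ) :
    HasDerivAt (cutoff ε) (2 * ε * max (-s) 0 / (ε + negPartSq s) ^ 2) s := by
  have hp : ε + negPartSq s ≠ 0 := by have := negPartSq_nonneg s; positivity
  have h := ((hasDerivAt_negPartSq s).div ((hasDerivAt_negPartSq s).const_add ε) hp).neg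
  refine h.congr_deriv ?_
  field_simp
  ring

lemma deriv_cutoff (hε : 0 < ε) (s : ℝ) :
    deriv (cutoff ε) s = 2 * ε * max (-s) 0 / (ε + negPartSq s) ^ 2 :=
  (hasDerivAt_cutoff hε s).deriv

lemma continuous_negPartSq : Continuous negPartSq :=
  continuous_iff_continuousAt.2 fun s => (hasDerivAt_negPartSq s).continuousAt

lemma contDiff_cutoff (hε : 0 < ε) : ContDiff ℝ 1 (cutoff ε) := by
  rw [contDiff_one_iff_deriv]
  refine ⟨fun s => (hasDerivAt_cutoff hε s).differentiableAt, ?_⟩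
  rw [funext (deriv_cutoff hε)]
  refine Continuous.div (by fun_prop) ((continuous_const.add continuous_negPartSq).pow 2)
    fun s => ?_
  have := negPartSq_nonneg s
  positivity

lemma deriv_cutoff_nonneg (hε : 0 < ε) (s : ℝ) : 0 ≤ deriv (cutoff ε) s := by
  rw [deriv_cutoff hε]
  have : 0 ≤ max (-s) 0 := le_max_right _ _
  positivity

lemma monotone_cutoff (hε : 0 < ε) : Monotone (cutoff ε) :=
  monotone_of_deriv_nonneg ((contDiff_cutoff hε).differentiable (by simp)) (deriv_cutoff_nonneg hε)

lemma abs_deriv_cutoff_le (hε : 0 < ε) (hε1 : ε ≤ 1) (s : ℝ) :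
    |deriv (cutoff ε) s| ≤ Real.toNNReal (1 / ε) := by
  rw [abs_of_nonneg (deriv_cutoff_nonneg hε s), deriv_cutoff hε, negPartSq,
    Real.coe_toNNReal _ (by positivity)]
  set r := max (-s) 0
  have hr : 0 ≤ r := le_max_right _ _
  rw [div_le_div_iff₀ (by positivity) hε]
  -- `2r ≤ 1 + r²` and `ε(1 + r²) ≤ ε + r²`.
  have h1 : 0 ≤ (1 - ε) * r ^ 2 := mul_nonneg (by linarith) (sq_nonneg r)
  have h2 : ε * (2 * r) ≤ ε + r ^ 2 := by nlinarith [sq_nonneg (r - 1)]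
  nlinarith [sq_nonneg r, mul_le_mul_of_nonneg_left h2 hε.le, mul_nonneg hε.le (sq_nonneg r)]

lemma cutoff_of_nonneg {s : ℝ} (hs : 0 ≤ s) : cutoff ε s = 0 := by
  simp [cutoff, negPartSq_of_nonneg hs]

lemma cutoff_neg (hε : 0 < ε) {s : ℝ} (hs : s < 0) : cutoff ε s < 0 := by
  have := negPartSq_pos hs
  rw [cutoff, neg_lt_zero]
  positivity

lemma cutoff_nonpos (hε : 0 < ε) (s : ℝ) : cutoff ε s ≤ 0 := by
  rcases le_or_gt 0 s with h | h
  · exact (cutoff_of_nonneg h).le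
  · exact (cutoff_neg hε h).le

lemma abs_cutoff_le_one (hε : 0 < ε) (s : ℝ) : |cutoff ε s| ≤ 1 := by
  have := negPartSq_nonneg s
  rw [cutoff, abs_neg, abs_of_nonneg (by positivity), div_le_one (by positivity)]
  linarith

lemma mul_cutoff_nonneg (hε : 0 < ε) (s : ℝ) : 0 ≤ s * cutoff ε s := by
  rcases le_or_gt 0 s with h | h
  · rw [cutoff_of_nonneg h, mul_zero]
  · exact mul_nonneg_of_nonpos_of_nonpos h.le (cutoff_nonpos hε s)

lemma cutoff_le_cutoff_one (hε : 0 < ε) (hε1 : ε ≤ 1) (s : ℝ) : cutoff ε s ≤ cutoff 1 s := by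
  have := negPartSq_nonneg s
  rw [cutoff, cutoff, neg_le_neg_iff]
  gcongr

lemma nonneg_of_cutoff_eq_zero (hε : 0 < ε) {s : ℝ} (h : cutoff ε s = 0) : 0 ≤ s := by
  by_contra hs
  exact (cutoff_neg hε (not_le.1 hs)).ne h

/-- `|s β'(s)| ≤ 1` for the cut-off function `β`, uniformly in `ε`. -/
lemma abs_mul_deriv_cutoff_le_one (hε : 0 < ε) (s : ℝ) : |s * deriv (cutoff ε) s| ≤ (1 : ℝ≥0) := by
  rw [deriv_cutoff hε]
  rcases le_or_gt 0 s with h | h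
  · rw [max_eq_right (by linarith)]; simp
  · rw [negPartSq, max_eq_left (by linarith), NNReal.coe_one, ← mul_div_assoc, abs_div,
      abs_of_nonneg (sq_nonneg (ε + _)), div_le_one (by positivity), abs_le]
    constructor <;> nlinarith [sq_nonneg (ε - s ^ 2), sq_nonneg s, mul_nonneg hε.le (sq_nonneg s)]

/-- `s β'(s) → 0` for the cut-off functions `β`, as `ε → 0`. -/
lemma tendsto_mul_deriv_cutoff {e : ℕ → ℝ} (he : ∀ k, 0 < e k) (he0 : Tendsto e atTop (𝓝 0))
    (s : ℝ) :
    Tendsto (fun k => s * deriv (cutoff (e k)) s) atTop (𝓝 0) := by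
  simp only [fun k => deriv_cutoff (he k) s]
  rcases le_or_gt 0 s with h | h
  · rw [max_eq_right (by linarith)]; simp
  · have hp := negPartSq_pos h
    have : Tendsto (fun k => s * (2 * e k * max (-s) 0 / (e k + negPartSq s) ^ 2)) atTop
        (𝓝 (s * (2 * 0 * max (-s) 0 / (0 + negPartSq s) ^ 2))) :=
      ((((he0.const_mul 2).mul_const _).div ((he0.add_const _).pow 2) (by positivity)).const_mul s)
    simpa using this

/-- The convex primitive of the cut-off function that vanishes on `[0,∞[`, an approximation of the
negative part. -/
noncomputable def cutoffPrimitive (ε s : ℝ) : ℝ := ∫ t in (0 : ℝ)..s, cutoff ε t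

lemma cutoff_intervalIntegrable (hε : 0 < ε) (a b : ℝ) :
    IntervalIntegrable (cutoff ε) volume a b :=
  (contDiff_cutoff hε).continuous.intervalIntegrable _ _

lemma cutoffPrimitive_sub (hε : 0 < ε) (a b : ℝ) :
    cutoffPrimitive ε a - cutoffPrimitive ε b = ∫ t in b..a, cutoff ε t :=
  intervalIntegral.integral_interval_sub_left (cutoff_intervalIntegrable hε _ _)
    (cutoff_intervalIntegrable hε _ _)

lemma cutoffPrimitive_sub_le (hε : 0 < ε) (a b : ℝ) :
    cutoffPrimitive ε a - cutoffPrimitive ε b ≤ (a - b) * cutoff ε a := by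
  rw [cutoffPrimitive_sub hε]
  rcases le_total b a with h | h
  · have := intervalIntegral.integral_mono_on h (cutoff_intervalIntegrable hε _ _)
      (intervalIntegrable_const (c := cutoff ε a)) fun t ht => monotone_cutoff hε ht.2
    simpa using this
  · have := intervalIntegral.integral_mono_on h (intervalIntegrable_const (c := cutoff ε a))
      (cutoff_intervalIntegrable hε _ _) fun t ht => monotone_cutoff hε ht.1
    rw [intervalIntegral.integral_symm]
    simp only [intervalIntegral.integral_const, smul_eq_mul] at this
    linarith

lemma cutoffPrimitive_of_nonneg {s : ℝ} (hs : 0 ≤ s) : cutoffPrimitive ε s = 0 := by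
  refine intervalIntegral.integral_zero_ae (Eventually.of_forall fun t ht => ?_)
  rw [uIoc_of_le hs] at ht
  exact cutoff_of_nonneg ht.1.le

lemma cutoffPrimitive_one_le (hε : 0 < ε) (hε1 : ε ≤ 1) (s : ℝ) :
    cutoffPrimitive 1 s ≤ cutoffPrimitive ε s := by
  rcases le_or_gt 0 s with h | h
  · rw [cutoffPrimitive_of_nonneg h, cutoffPrimitive_of_nonneg h]
  · rw [cutoffPrimitive, cutoffPrimitive, intervalIntegral.integral_symm,
      intervalIntegral.integral_symm s, neg_le_neg_iff]
    exact intervalIntegral.integral_mono_on h.le (cutoff_intervalIntegrable hε _ _)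
      (cutoff_intervalIntegrable one_pos _ _) fun t _ => cutoff_le_cutoff_one hε hε1 t

lemma cutoffPrimitive_nonneg (hε : 0 < ε) (s : ℝ) : 0 ≤ cutoffPrimitive ε s := by
  rcases le_or_gt 0 s with h | h
  · rw [cutoffPrimitive_of_nonneg h]
  · have h1 := cutoffPrimitive_sub_le hε 0 s
    rw [cutoffPrimitive_of_nonneg le_rfl, cutoff_of_nonneg le_rfl] at h1
    linarith

lemma nonneg_of_cutoffPrimitive_eq_zero (hε : 0 < ε) {s : ℝ} (h : cutoffPrimitive ε s = 0) :
    0 ≤ s := by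
  by_contra hs
  rw [not_le] at hs
  have h1 := cutoffPrimitive_sub_le hε (s / 2) s
  have h2 := cutoffPrimitive_nonneg hε (s / 2)
  have h3 := cutoff_neg hε (by linarith : s / 2 < 0)
  nlinarith

lemma lipschitzWith_cutoffPrimitive (hε : 0 < ε) : LipschitzWith 1 (cutoffPrimitive ε) := by
  refine LipschitzWith.of_dist_le_mul fun a b => ?_
  rw [Real.dist_eq, Real.dist_eq, cutoffPrimitive_sub hε]
  exact intervalIntegral.norm_integral_le_of_norm_le_const (f := cutoff ε) (C := (1 : ℝ≥0))
    fun t _ => abs_cutoff_le_one hε t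

end NegPart

/-! ### The negative mass and test functions -/

section Inclusion

open Filter Topology
open scoped NNReal

variable {α F : Type*} [MeasurableSpace α] {ν : Measure α} [IsFiniteMeasure ν]
  [NormedAddCommGroup F] {p : ℝ≥0∞}

/-- The inclusion `L^p ⊆ L²` on a finite measure space, for `p ≥ 2`. -/
noncomputable def toL2 (hp : 2 ≤ p) (f : Lp F p ν) : Lp F 2 ν :=
  ((Lp.memLp f).mono_exponent hp).toLp f

lemma coeFn_toL2 (hp : 2 ≤ p) (f : Lp F p ν) : toL2 hp f =ᵐ[ν] f := MemLp.coeFn_toLp _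

lemma lipschitzWith_toL2 (hp : 2 ≤ p) [Fact (1 ≤ p)] :
    ∃ C : ℝ≥0, LipschitzWith C (toL2 hp : Lp F p ν → Lp F 2 ν) := by
  set c := ν univ ^ (1 / (2 : ℝ≥0∞).toReal - 1 / p.toReal) with hc
  have hexp : 0 ≤ 1 / (2 : ℝ≥0∞).toReal - 1 / p.toReal := by
    rcases eq_or_ne p ⊤ with rfl | hpt
    · simp
    · rw [sub_nonneg]
      exact one_div_le_one_div_of_le (by simp) (ENNReal.toReal_mono hpt hp)
  have hct : c ≠ ⊤ := ENNReal.rpow_ne_top_of_nonneg hexp (measure_ne_top ν univ)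
  refine ⟨c.toNNReal, fun f g => ?_⟩
  rw [Lp.edist_def, Lp.edist_def, ENNReal.coe_toNNReal hct, mul_comm,
    eLpNorm_congr_ae ((coeFn_toL2 hp f).sub (coeFn_toL2 hp g))]
  exact eLpNorm_le_eLpNorm_mul_rpow_measure_univ hp
    ((Lp.aestronglyMeasurable f).sub (Lp.aestronglyMeasurable g))

lemma memLp_toL2 (hp : 2 ≤ p) [Fact (1 ≤ p)] {β : Type*} [MeasurableSpace β] {κ : Measure β}
    {f : β → Lp F p ν} (hf : MemLp f 2 κ) : MemLp (fun t => toL2 hp (f t)) 2 κ := by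
  obtain ⟨C, hC⟩ := lipschitzWith_toL2 (F := F) (ν := ν) hp
  have h0 : toL2 hp (0 : Lp F p ν) = 0 := by
    refine Lp.ext ?_
    filter_upwards [coeFn_toL2 hp (0 : Lp F p ν), Lp.coeFn_zero F p ν, Lp.coeFn_zero F 2 ν]
      with x h1 h2 h3
    rw [h1, h2, h3]
  exact hC.comp_memLp h0 hf

end Inclusion

section NegativeMass

open Filter Topology
open scoped NNReal

variable {n : ℕ} {Ω : Set (Sp n)} {ε : ℝ}

lemma isFiniteMeasure_vol (hb : Bornology.IsBounded Ω) : IsFiniteMeasure (vol Ω) :=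
  ⟨by simpa using hb.measure_lt_top⟩

/-- The integral over `Ω` of the regularised negative part. -/
noncomputable def negMass (ε : ℝ) (f : Lp ℝ 2 (vol Ω)) : ℝ := ∫ x in Ω, cutoffPrimitive ε (f x)

lemma integrable_cutoffPrimitive (hb : Bornology.IsBounded Ω) (hε : 0 < ε) (f : Lp ℝ 2 (vol Ω)) :
    Integrable (fun x => cutoffPrimitive ε (f x)) (vol Ω) := by
  have := isFiniteMeasure_vol hb
  exact ((lipschitzWith_cutoffPrimitive hε).comp_memLp (cutoffPrimitive_of_nonneg le_rfl)
    (Lp.memLp f)).integrable (by simp)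

lemma continuous_negMass (hb : Bornology.IsBounded Ω) (hε : 0 < ε) :
    Continuous (negMass ε : Lp ℝ 2 (vol Ω) → ℝ) := by
  have := isFiniteMeasure_vol hb
  have hL := lipschitzWith_cutoffPrimitive hε
  have h0 : cutoffPrimitive ε 0 = 0 := cutoffPrimitive_of_nonneg le_rfl
  have h1 : MemLp (fun _ : Sp n => (1 : ℝ)) 2 (vol Ω) := memLp_const 1
  have e : (negMass ε : Lp ℝ 2 (vol Ω) → ℝ) = fun f => inner ℝ (h1.toLp _) (hL.compLp h0 f) := by
    ext f
    rw [L2.inner_def, negMass]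
    refine integral_congr_ae ?_
    filter_upwards [h1.coeFn_toLp, hL.coeFn_compLp h0 f] with x h2 h3
    rw [h2, h3]
    simp
  rw [e]
  exact continuous_const.inner (hL.continuous_compLp h0)

lemma negMass_nonneg (hε : 0 < ε) (f : Lp ℝ 2 (vol Ω)) : 0 ≤ negMass ε f :=
  integral_nonneg fun _ => cutoffPrimitive_nonneg hε _

lemma negMass_eq_zero_of_nonneg {f : Lp ℝ 2 (vol Ω)} (hf : ∀ᵐ x ∂(vol Ω), 0 ≤ f x) :
    negMass ε f = 0 :=
  integral_eq_zero_of_ae (hf.mono fun _ hx => cutoffPrimitive_of_nonneg hx)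

lemma nonneg_of_negMass_eq_zero (hb : Bornology.IsBounded Ω) (hε : 0 < ε) {f : Lp ℝ 2 (vol Ω)}
    (hf : negMass ε f = 0) : ∀ᵐ x ∂(vol Ω), 0 ≤ f x := by
  have h := (integral_eq_zero_iff_of_nonneg (fun x => cutoffPrimitive_nonneg hε (f x))
    (integrable_cutoffPrimitive hb hε f)).1 hf
  exact h.mono fun x hx => nonneg_of_cutoffPrimitive_eq_zero hε hx

lemma negMass_one_le (hb : Bornology.IsBounded Ω) (hε : 0 < ε) (hε1 : ε ≤ 1) (f : Lp ℝ 2 (vol Ω)) :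
    negMass 1 f ≤ negMass ε f :=
  integral_mono (integrable_cutoffPrimitive hb one_pos f) (integrable_cutoffPrimitive hb hε f)
    fun x => cutoffPrimitive_one_le hε hε1 (f x)

/-- `β(f)` is a subgradient at `f` of the regularised negative mass with density `∫₀ˢ β`. -/
lemma negMass_sub_le (hb : Bornology.IsBounded Ω) (hε : 0 < ε) {f b : Lp ℝ 2 (vol Ω)}
    (hfb : b =ᵐ[vol Ω] fun x => cutoff ε (f x)) (g : Lp ℝ 2 (vol Ω)) :
    negMass ε f - negMass ε g ≤ inner ℝ (f - g) b := by
  rw [negMass, negMass, ← integral_sub (integrable_cutoffPrimitive hb hε f)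
    (integrable_cutoffPrimitive hb hε g), L2.inner_def]
  refine integral_mono_ae ((integrable_cutoffPrimitive hb hε f).sub
    (integrable_cutoffPrimitive hb hε g)) (L2.integrable_inner _ _) ?_
  filter_upwards [hfb, Lp.coeFn_sub f g] with x h1 h2
  rw [h1, h2, Pi.sub_apply]
  have := cutoffPrimitive_sub_le hε (f x) (g x)
  simpa [mul_comm] using this

end NegativeMass

section Solution

open Filter Topology
open scoped NNReal

variable {n : ℕ} {Ω Γ : Set (Sp n)} {T ℓ : ℝ}

/-- The time derivative of the pairing with a fixed element of `H¹(Ω)`, in integrated form. -/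
lemma IsTimeDerivative.inner_sub_inner_eq (hT : 0 < T) {u : ℝ → H1 Ω} {u' : ℝ → H1 Ω →L[ℝ] ℝ}
    (h : IsTimeDerivative T u u') (hu' : MemLp u' 2 (timeMeasure T)) {U : ℝ → Lp ℝ 2 (vol Ω)}
    (hU : ContinuousOn U (Icc 0 T)) (hUu : ∀ᵐ t ∂(timeMeasure T), U t = val (u t)) :
    ∀ t ∈ Icc 0 T, ∀ w : H1 Ω, inner ℝ (U t) (val w) - inner ℝ (U 0) (val w) =
      ∫ s in (0 : ℝ)..t, u' s w := by
  intro t ht w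
  refine sub_eq_integral_of_weak_derivative hT (f := fun t => inner ℝ (U t) (val w))
    (hU.inner continuousOn_const) ?_ (fun ψ h1 h2 h3 => ?_) t ht
  · exact (ContinuousLinearMap.apply ℝ ℝ w).integrable_comp (hu'.integrable (by simp))
  · rw [h ψ h1 h2 h3 w]
    congr 1
    refine integral_congr_ae ?_
    filter_upwards [hUu] with s hs
    rw [hs]

/-- An element of `L²(0,T; H¹(Ω))` with bounded trace is a test function, since
`|s|^ℓ ≤ C^{ℓ-2} s²` for `|s| ≤ C`. -/
lemma isTest_of_bounded_trace (hℓ : 2 ≤ ℓ) {v : ℝ → H1 Ω} (hv : MemLp v 2 (timeMeasure T)) {C : ℝ}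
    (hC : ∀ t ∈ Ioo 0 T, ∀ᵐ x ∂(surf Ω), |trace Ω (v t) x| ≤ C) : IsTest Ω Γ T ℓ v := by
  refine ⟨hv, ?_⟩
  have hC' : ∀ t ∈ Ioo 0 T, ∀ᵐ x ∂(surf Ω), |trace Ω (v t) x| ≤ |C| := fun t ht =>
    (hC t ht).mono fun x hx => hx.trans (le_abs_self C)
  have h1 : ∀ t ∈ Ioo 0 T, ∫⁻ x in Γ, ‖trace Ω (v t) x‖ₑ ^ ℓ ∂(surf Ω) ≤
      ENNReal.ofReal (|C| ^ (ℓ - 2)) * (‖trace Ω‖ₑ ^ 2 * ‖v t‖ₑ ^ 2) := by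
    intro t ht
    calc ∫⁻ x in Γ, ‖trace Ω (v t) x‖ₑ ^ ℓ ∂(surf Ω)
        ≤ ∫⁻ x, ‖trace Ω (v t) x‖ₑ ^ ℓ ∂(surf Ω) := lintegral_mono' Measure.restrict_le_self le_rfl
      _ ≤ ∫⁻ x, ENNReal.ofReal (|C| ^ (ℓ - 2)) * ‖trace Ω (v t) x‖ₑ ^ 2 ∂(surf Ω) := by
          refine lintegral_mono_ae ?_
          filter_upwards [hC' t ht] with x hx
          have e1 : ‖trace Ω (v t) x‖ₑ ^ ℓ =
              ‖trace Ω (v t) x‖ₑ ^ (ℓ - 2) * ‖trace Ω (v t) x‖ₑ ^ 2 := by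
            rw [← ENNReal.rpow_natCast, ← ENNReal.rpow_add_of_nonneg _ _ (by linarith) (by simp)]
            congr 1
            norm_num
          rw [e1, ← ENNReal.ofReal_rpow_of_nonneg (abs_nonneg C) (by linarith)]
          gcongr
          rw [← ofReal_norm, Real.norm_eq_abs]
          exact ENNReal.ofReal_le_ofReal hx
      _ = ENNReal.ofReal (|C| ^ (ℓ - 2)) * ‖trace Ω (v t)‖ₑ ^ 2 := by
          rw [lintegral_const_mul' _ _ ENNReal.ofReal_ne_top, ← eLpNorm_two_sq, Lp.enorm_def]
      _ ≤ _ := by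
          gcongr
          rw [← mul_pow]
          gcongr
          exact (trace Ω).le_opENorm (v t)
  calc ∫⁻ t in Ioo 0 T, ∫⁻ x in Γ, ‖trace Ω (v t) x‖ₑ ^ ℓ ∂(surf Ω)
      ≤ ∫⁻ t in Ioo 0 T, ENNReal.ofReal (|C| ^ (ℓ - 2)) * (‖trace Ω‖ₑ ^ 2 * ‖v t‖ₑ ^ 2) := by
        refine lintegral_mono_ae ?_
        filter_upwards [ae_restrict_mem measurableSet_Ioo] with t ht
        exact h1 t ht
    _ = ENNReal.ofReal (|C| ^ (ℓ - 2)) * (‖trace Ω‖ₑ ^ 2 * eLpNorm v 2 (timeMeasure T) ^ 2) := by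
        rw [lintegral_const_mul' _ _ ENNReal.ofReal_ne_top,
          lintegral_const_mul' _ _ (by simp), eLpNorm_two_sq]
    _ < ⊤ := by
        refine ENNReal.mul_lt_top ENNReal.ofReal_lt_top (ENNReal.mul_lt_top ?_
          (ENNReal.pow_lt_top hv.2))
        simp [enorm_lt_top]

end Solution

/-! ### The energy estimate -/

section Energy

open Filter Topology
open scoped NNReal

variable {n : ℕ} {Ω Γ : Set (Sp n)} {T ℓ : ℝ} {ε : ℝ}

/-- The element `β(v)` of `H¹(Ω)` for the cut-off function `β`. -/
noncomputable def cutoffComp (hΩ : IsLipschitzDomain Ω) (hε : 0 < ε) (hε1 : ε ≤ 1) (v : H1 Ω) :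
    H1 Ω :=
  H1.comp hΩ (contDiff_cutoff hε) (cutoff_of_nonneg le_rfl) (abs_deriv_cutoff_le hε hε1) v

lemma continuous_mul_deriv_cutoff (hε : 0 < ε) : Continuous fun s => s * deriv (cutoff ε) s :=
  continuous_id.mul ((contDiff_cutoff hε).continuous_deriv (by simp))

/-- The vector field `γ(v)∇v` in `L²(Ω)`, with `γ(s) = s β'(s)` for the cut-off function `β`; it is
`v ∇(β(v))`. -/
noncomputable def driftField (hε : 0 < ε) (v : H1 Ω) : Lp (Sp n) 2 (vol Ω) :=
  smulComp (continuous_mul_deriv_cutoff hε) (abs_mul_deriv_cutoff_le_one hε) (val v) (grad v)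

lemma trace_smul_cutoffComp (hΩ : IsLipschitzDomain Ω) (hε : 0 < ε) (hε1 : ε ≤ 1) (v : H1 Ω)
    (c : ℝ) : trace Ω (c • cutoffComp hΩ hε hε1 v) =ᵐ[surf Ω]
      fun x => c * cutoff ε (trace Ω v x) := by
  rw [map_smul]
  filter_upwards [Lp.coeFn_smul c (trace Ω (cutoffComp hΩ hε hε1 v)),
    trace_comp hΩ (contDiff_cutoff hε) (cutoff_of_nonneg le_rfl) (abs_deriv_cutoff_le hε hε1) v]
    with x h1 h2
  rw [h1, Pi.smul_apply, cutoffComp, h2, smul_eq_mul]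

lemma grad_smul_cutoffComp (hΩ : IsLipschitzDomain Ω) (hε : 0 < ε) (hε1 : ε ≤ 1) (v : H1 Ω)
    (c : ℝ) : grad (c • cutoffComp hΩ hε hε1 v) =ᵐ[vol Ω]
      fun x => (c * deriv (cutoff ε) (val v x)) • grad v x := by
  rw [grad_smul]
  filter_upwards [Lp.coeFn_smul c (grad (cutoffComp hΩ hε hε1 v)),
    H1.grad_comp hΩ (contDiff_cutoff hε) (cutoff_of_nonneg le_rfl) (abs_deriv_cutoff_le hε hε1) v]
    with x h1 h2
  rw [h1, Pi.smul_apply, cutoffComp, h2, smul_smul]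

/-- The equation tested with `(T - t) β(u)`, where `β` is the cut-off function: the elliptic term
and the boundary term are nonnegative, the term with `h` is nonpositive, and what is left to bound
the negative mass is the drift term. -/
lemma integral_negMass_le (hΩ : IsLipschitzDomain Ω) (hT : 0 < T)
    {A : Sp n → Matrix (Fin n) (Fin n) ℝ} (hA : IsEllipticMatrix Ω A) (hℓ : 2 ≤ ℓ)
    {b : Sp n → ℝ → ℝ} (hb : IsBoundaryCoefficient Ω Γ ℓ b) {q : ℝ≥0∞} (hq : 2 ≤ q)
    {E : ℝ → Lp (Sp n) q (vol Ω)} [IsFiniteMeasure (vol Ω)]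
    {h : ℝ → Lp ℝ 2 ((surf Ω).restrict Γ)}
    (hh : ∀ᵐ t ∂(timeMeasure T), ∀ᵐ x ∂((surf Ω).restrict Γ), 0 ≤ h t x)
    {u₀ : Lp ℝ 2 (vol Ω)} (hu₀ : ∀ᵐ x ∂(vol Ω), 0 ≤ u₀ x) {u : ℝ → H1 Ω}
    (hu : IsWeakSolution Ω Γ T ℓ A b E h u₀ u) {U : ℝ → Lp ℝ 2 (vol Ω)}
    (hU : ContinuousOn U (Icc 0 T)) (hUu : ∀ᵐ t ∂(timeMeasure T), U t = val (u t))
    (hU0 : U 0 = u₀) (hε : 0 < ε) (hε1 : ε ≤ 1) {a : ℝ} (ha : 0 ≤ a) (haT : a < T) :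
    ∫ t in (0 : ℝ)..a, negMass ε (U t) ≤
      ∫ t in Ioo 0 T, (T - t) * inner ℝ (toL2 hq (E t)) (driftField hε (u t)) := by
  obtain ⟨u', hu'2, hu'd, heq⟩ := hu.equation
  set w : ℝ → H1 Ω := fun t => cutoffComp hΩ hε hε1 (u t) with hw
  have hw2 : MemLp w 2 (timeMeasure T) := by
    refine hu.memLp_two.of_le_mul (c := 2 * Real.toNNReal (1 / ε))
      ((H1.continuous_comp hΩ (contDiff_cutoff hε) (cutoff_of_nonneg le_rfl)
        (abs_deriv_cutoff_le hε hε1)).comp_aestronglyMeasurable hu.memLp_two.1)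
      (Eventually.of_forall fun t => H1.norm_comp_le hΩ _ _ _ (u t))
  set v : ℝ → H1 Ω := fun t => (T - t) • w t with hv
  have hv2 : MemLp v 2 (timeMeasure T) := memLp_weight_smul hT hw2
  have htr : ∀ t, trace Ω (v t) =ᵐ[surf Ω] fun x => (T - t) * cutoff ε (trace Ω (u t) x) :=
    fun t => trace_smul_cutoffComp hΩ hε hε1 (u t) (T - t)
  have hgr : ∀ t, grad (v t) =ᵐ[vol Ω]
      fun x => ((T - t) * deriv (cutoff ε) (val (u t) x)) • grad (u t) x :=
    fun t => grad_smul_cutoffComp hΩ hε hε1 (u t) (T - t)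
  have htest : IsTest Ω Γ T ℓ v := by
    refine isTest_of_bounded_trace hℓ hv2 (C := T) fun t ht => ?_
    filter_upwards [htr t] with x hx
    rw [hx, abs_mul, abs_of_nonneg (by linarith [ht.2])]
    have := abs_cutoff_le_one hε (trace Ω (u t) x)
    nlinarith [ht.1, ht.2, abs_nonneg (cutoff ε (trace Ω (u t) x))]
  obtain ⟨-, heq⟩ := heq v htest
  -- `β(u(t))` is a subgradient of the negative mass at `u(t)`.
  have hmass := integral_le_integral_weight_mul_apply ha haT hU hu'2
    (hu'd.inner_sub_inner_eq hT hu'2 hU hUu) (continuous_negMass hΩ.isBounded hε)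
    (negMass_nonneg hε) (by rw [hU0]; exact negMass_eq_zero_of_nonneg hu₀) hw2 (by
      filter_upwards [hUu] with t ht y
      refine negMass_sub_le hΩ.isBounded hε ?_ y
      rw [ht]
      exact H1.val_comp hΩ _ _ _ (u t))
  -- The next three signs need no integrability: the integrands have a sign almost everywhere.
  have hell : 0 ≤ ∫ t in Ioo 0 T,
      ∫ x in Ω, ∑ i, ∑ j, A x i j * grad (u t) x j * grad (v t) x i := by
    obtain ⟨α, hα, hA'⟩ := hA.elliptic
    refine setIntegral_nonneg measurableSet_Ioo fun t ht => integral_nonneg_of_ae ?_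
    filter_upwards [hA', hgr t] with x h1 h2
    have e : ∑ i, ∑ j, A x i j * grad (u t) x j * grad (v t) x i =
        ((T - t) * deriv (cutoff ε) (val (u t) x)) *
          ∑ i, ∑ j, A x i j * grad (u t) x i * grad (u t) x j := by
      rw [Finset.mul_sum]
      refine Finset.sum_congr rfl fun i _ => ?_
      rw [Finset.mul_sum]
      refine Finset.sum_congr rfl fun j _ => ?_
      rw [h2, PiLp.smul_apply, smul_eq_mul]
      ring
    rw [Pi.zero_apply, e]
    refine mul_nonneg (mul_nonneg (by linarith [ht.2]) (deriv_cutoff_nonneg hε _)) ?_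
    exact (by positivity : 0 ≤ α * ‖grad (u t) x‖ ^ 2).trans (h1 _)
  have hbd : 0 ≤ ∫ t in Ioo 0 T, ∫ x in Γ,
      b x (trace Ω (u t) x) * trace Ω (u t) x * trace Ω (v t) x ∂(surf Ω) := by
    obtain ⟨bsup, -, hb'⟩ := hb.growth
    refine setIntegral_nonneg measurableSet_Ioo fun t ht => integral_nonneg_of_ae ?_
    filter_upwards [hb', ae_restrict_of_ae (htr t)] with x h1 h2
    rw [Pi.zero_apply, h2]
    have h3 := mul_nonneg (h1 (trace Ω (u t) x)).1 (mul_cutoff_nonneg hε (trace Ω (u t) x))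
    have h4 := mul_nonneg (by linarith [ht.2] : 0 ≤ T - t) h3
    linarith
  have hsrc : ∫ t in Ioo 0 T, ∫ x in Γ, h t x * trace Ω (v t) x ∂(surf Ω) ≤ 0 := by
    refine integral_nonpos_of_ae ?_
    filter_upwards [hh, ae_restrict_mem measurableSet_Ioo] with t h1 ht
    refine integral_nonpos_of_ae ?_
    filter_upwards [h1, ae_restrict_of_ae (htr t)] with x h2 h3
    rw [Pi.zero_apply, h3]
    exact mul_nonpos_of_nonneg_of_nonpos h2
      (mul_nonpos_of_nonneg_of_nonpos (by linarith [ht.2]) (cutoff_nonpos hε _))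
  -- In `val u * ⟪E, ∇v⟫` the factor `val u` is absorbed by `β'(u)`.
  have hdrift : ∫ t in Ioo 0 T, ∫ x in Ω, val (u t) x * inner ℝ (E t x) (grad (v t) x) =
      ∫ t in Ioo 0 T, (T - t) * inner ℝ (toL2 hq (E t)) (driftField hε (u t)) := by
    refine integral_congr_ae (Eventually.of_forall fun t => ?_)
    dsimp only
    rw [L2.inner_def, ← integral_const_mul]
    refine integral_congr_ae ?_
    filter_upwards [hgr t, coeFn_toL2 hq (E t), coeFn_smulComp (continuous_mul_deriv_cutoff hε)
      (abs_mul_deriv_cutoff_le_one hε) (val (u t)) (grad (u t))] with x h1 h2 h3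
    rw [h1, h2, driftField, h3, inner_smul_right, inner_smul_right]
    ring
  rw [hdrift] at heq
  linarith

/-- The drift terms tend to `0` as the cut-off functions tend to a step function, by dominated
convergence in space and in time. -/
lemma tendsto_drift {e : ℕ → ℝ} (he : ∀ k, 0 < e k) (he0 : Tendsto e atTop (𝓝 0))
    {F : ℝ → Lp (Sp n) 2 (vol Ω)} (hF : MemLp F 2 (timeMeasure T)) {u : ℝ → H1 Ω}
    (hu : MemLp u 2 (timeMeasure T)) :
    Tendsto (fun k => ∫ t in Ioo 0 T, (T - t) * inner ℝ (F t) (driftField (he k) (u t)))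
      atTop (𝓝 0) := by
  have hspace : ∀ (f : Lp (Sp n) 2 (vol Ω)) (v : H1 Ω),
      Tendsto (fun k => inner ℝ f (driftField (he k) v)) atTop (𝓝 0) := by
    intro f v
    have h0 : (0 : ℝ) = ∫ _ in Ω, (0 : ℝ) := by simp
    rw [h0]
    simp only [L2.inner_def]
    refine tendsto_integral_of_dominated_convergence (fun x => ‖f x‖ * ‖grad v x‖)
      (fun k => (L2.integrable_inner _ _).1) ?_ (fun k => ?_) ?_
    · exact (Lp.memLp f).norm.integrable_mul (Lp.memLp (grad v)).norm
    · filter_upwards [coeFn_smulComp (continuous_mul_deriv_cutoff (he k))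
        (abs_mul_deriv_cutoff_le_one (he k)) (val v) (grad v)] with x hx
      refine (norm_inner_le_norm _ _).trans ?_
      rw [driftField, hx, norm_smul]
      gcongr
      have := abs_mul_deriv_cutoff_le_one (he k) (val v x)
      rw [Real.norm_eq_abs]
      exact mul_le_of_le_one_left (norm_nonneg _) this
    · have hall : ∀ᵐ x ∂(vol Ω), ∀ k, driftField (he k) v x =
          (val v x * deriv (cutoff (e k)) (val v x)) • grad v x :=
        ae_all_iff.2 fun k => coeFn_smulComp (continuous_mul_deriv_cutoff (he k))
          (abs_mul_deriv_cutoff_le_one (he k)) (val v) (grad v)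
      filter_upwards [hall] with x hx
      simp only [hx, inner_smul_right]
      simpa using (tendsto_mul_deriv_cutoff he he0 (val v x)).mul_const (inner ℝ (f x) (grad v x))
  have h0 : 𝓝 (0 : ℝ) = 𝓝 (∫ _ in Ioo 0 T, (0 : ℝ)) := by simp
  rw [h0]
  refine tendsto_integral_of_dominated_convergence (fun t => T * (‖F t‖ * ‖u t‖))
    (fun k => ?_) ?_ (fun k => ?_) ?_
  · have hc : Continuous (driftField (Ω := Ω) (he k)) :=
      (continuous_smulComp (continuous_mul_deriv_cutoff (he k))
        (abs_mul_deriv_cutoff_le_one (he k))).comp (continuous_val.prodMk continuous_grad)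
    exact (by fun_prop : Continuous fun t : ℝ => T - t).aestronglyMeasurable.mul
      (hF.1.inner (hc.comp_aestronglyMeasurable hu.1))
  · exact (hF.norm.integrable_mul hu.norm).const_mul T
  · filter_upwards [ae_restrict_mem measurableSet_Ioo] with t ht
    rw [norm_mul, Real.norm_of_nonneg (by linarith [ht.2])]
    have h1 : ‖driftField (he k) (u t)‖ ≤ ‖u t‖ := by
      refine (norm_smulComp_le (continuous_mul_deriv_cutoff (he k))
        (abs_mul_deriv_cutoff_le_one (he k)) (val (u t)) (grad (u t))).trans ?_
      rw [NNReal.coe_one, one_mul]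
      exact norm_grad_le _
    have h2 : ‖inner ℝ (F t) (driftField (he k) (u t))‖ ≤ ‖F t‖ * ‖u t‖ :=
      (norm_inner_le_norm _ _).trans (by gcongr)
    exact mul_le_mul (by linarith [ht.1]) h2 (norm_nonneg _) (ht.1.trans ht.2).le
  · refine Eventually.of_forall fun t => ?_
    simpa using (hspace (F t) (u t)).const_mul (T - t)

/-- A nonnegative element of `H¹(Ω)` has a nonnegative trace: `β(v) = 0` for the cut-off function
`β`, hence `β` vanishes on the trace of `v`. -/
lemma trace_nonneg (hΩ : IsLipschitzDomain Ω) {v : H1 Ω} (hv : ∀ᵐ x ∂(vol Ω), 0 ≤ val v x) :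
    ∀ᵐ x ∂(surf Ω), 0 ≤ trace Ω v x := by
  have h0 : cutoffComp hΩ one_pos le_rfl v = 0 := by
    refine H1.ext ?_ ?_
    · refine Lp.ext ?_
      filter_upwards [hv, H1.val_comp hΩ (contDiff_cutoff one_pos) (cutoff_of_nonneg le_rfl)
        (abs_deriv_cutoff_le one_pos le_rfl) v, Lp.coeFn_zero ℝ 2 (vol Ω)] with x h1 h2 h3
      rw [cutoffComp, h2, cutoff_of_nonneg h1]
      exact h3.symm
    · refine Lp.ext ?_
      filter_upwards [hv, H1.grad_comp hΩ (contDiff_cutoff one_pos) (cutoff_of_nonneg le_rfl)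
        (abs_deriv_cutoff_le one_pos le_rfl) v, Lp.coeFn_zero (Sp n) 2 (vol Ω)] with x h1 h2 h3
      rw [cutoffComp, h2, deriv_cutoff one_pos, max_eq_right (by linarith)]
      simp only [mul_zero, zero_div, zero_smul]
      exact h3.symm
  have h1 := trace_comp hΩ (contDiff_cutoff one_pos) (cutoff_of_nonneg le_rfl)
    (abs_deriv_cutoff_le one_pos le_rfl) v
  change trace Ω (cutoffComp hΩ one_pos le_rfl v) =ᵐ[surf Ω] _ at h1
  rw [h0, map_zero] at h1
  filter_upwards [h1, Lp.coeFn_zero ℝ 2 (surf Ω)] with x h2 h3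
  refine nonneg_of_cutoff_eq_zero one_pos ?_
  rw [← h2, h3, Pi.zero_apply]

end Energy

end NeumannRobin

theorem theorem6 {n : ℕ} (hn : 2 ≤ n)
    (Ω : Set (NeumannRobin.Sp n)) (hΩ : NeumannRobin.IsLipschitzDomain Ω)
    (Γ : Set (NeumannRobin.Sp n)) (hΓ : ∃ O, IsOpen O ∧ Γ = O ∩ frontier Ω)
    (T : ℝ) (hT : 0 < T)
    (A : NeumannRobin.Sp n → Matrix (Fin n) (Fin n) ℝ) (hA : NeumannRobin.IsEllipticMatrix Ω A)
    (ℓ : ℝ) (hℓ₂ : 2 ≤ ℓ) (hℓ₃ : ℓ ≤ 3)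
    (b : NeumannRobin.Sp n → ℝ → ℝ) (hb : NeumannRobin.IsBoundaryCoefficient Ω Γ ℓ b)
    (q θ : ℝ) [Fact (1 ≤ ENNReal.ofReal q)] (hq : (n : ℝ) < q)
    (hθ₂ : n = 2 → 0 < θ ∧ θ < 1 - 2 / q) (hθ : 2 < n → θ = 0)
    (E : ℝ → Lp (NeumannRobin.Sp n) (ENNReal.ofReal q) (NeumannRobin.vol Ω))
    (hE : MemLp E (ENNReal.ofReal (2 / (1 - n / q - θ))) (NeumannRobin.timeMeasure T))
    (h : ℝ → Lp ℝ 2 ((NeumannRobin.surf Ω).restrict Γ))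
    (hh : MemLp h 2 (NeumannRobin.timeMeasure T))
    (hh_nonneg : ∀ᵐ t ∂(NeumannRobin.timeMeasure T),
      ∀ᵐ x ∂((NeumannRobin.surf Ω).restrict Γ), 0 ≤ h t x)
    (u₀ : Lp ℝ 2 (NeumannRobin.vol Ω)) (hu₀ : ∀ᵐ x ∂(NeumannRobin.vol Ω), 0 ≤ u₀ x)
    (u : ℝ → NeumannRobin.H1 Ω)
    (hu : NeumannRobin.IsWeakSolution Ω Γ T ℓ A b E h u₀ u) :
    (∀ᵐ t ∂(NeumannRobin.timeMeasure T), ∀ᵐ x ∂(NeumannRobin.vol Ω),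
      0 ≤ NeumannRobin.val (u t) x) ∧
    (∀ᵐ t ∂(NeumannRobin.timeMeasure T), ∀ᵐ x ∂((NeumannRobin.surf Ω).restrict Γ),
      0 ≤ NeumannRobin.trace Ω (u t) x) := by
  have hn2 : (2 : ℝ) ≤ n := by exact_mod_cast hn
  have hq0 : 0 < q := by linarith
  have hq2 : (2 : ℝ≥0∞) ≤ ENNReal.ofReal q := by
    rw [← ENNReal.ofReal_ofNat]
    exact ENNReal.ofReal_le_ofReal (by linarith)
  -- The time exponent is at least `2`, so `E` is square integrable.
  have hexp : (2 : ℝ≥0∞) ≤ ENNReal.ofReal (2 / (1 - n / q - θ)) := by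
    have h1 : 0 ≤ (n : ℝ) / q := by positivity
    have h2 : (n : ℝ) / q < 1 := (div_lt_one hq0).2 hq
    have h3 : 0 < 1 - n / q - θ ∧ 0 ≤ θ := by
      rcases hn.eq_or_lt with h | h
      · obtain ⟨h4, h5⟩ := hθ₂ h.symm
        subst h
        push_cast at *
        exact ⟨by linarith, h4.le⟩
      · rw [hθ h]
        exact ⟨by linarith, le_rfl⟩
    rw [← ENNReal.ofReal_ofNat]
    refine ENNReal.ofReal_le_ofReal ?_
    rw [le_div_iff₀ h3.1]
    linarith [h3.2]
  have hfin := NeumannRobin.isFiniteMeasure_vol hΩ.isBounded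
  have hE2 := NeumannRobin.memLp_toL2 hq2 (hE.mono_exponent hexp)
  obtain ⟨U, hU, hUu, hU0⟩ := hu.initial
  have he : ∀ k : ℕ, (0 : ℝ) < 1 / ((k : ℝ) + 1) := fun k => by positivity
  have he1 : ∀ k : ℕ, 1 / ((k : ℝ) + 1) ≤ 1 := fun k => by
    rw [div_le_one (by positivity)]
    linarith [(Nat.cast_nonneg k : (0 : ℝ) ≤ k)]
  have hdrift := NeumannRobin.tendsto_drift he tendsto_one_div_add_atTop_nhds_zero_nat hE2
    hu.memLp_two
  have hmc : ContinuousOn (fun t => NeumannRobin.negMass 1 (U t)) (Icc 0 T) :=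
    (NeumannRobin.continuous_negMass hΩ.isBounded one_pos).comp_continuousOn hU
  have hint : ∀ a, 0 ≤ a → a < T → ∫ t in (0 : ℝ)..a, NeumannRobin.negMass 1 (U t) ≤ 0 := by
    intro a ha haT
    refine ge_of_tendsto' hdrift fun k => ?_
    refine le_trans ?_ (NeumannRobin.integral_negMass_le hΩ hT hA hℓ₂ hb hq2 hh_nonneg hu₀ hu hU
      hUu hU0 (he k) (he1 k) ha haT)
    have hUa : ContinuousOn U (uIcc 0 a) :=
      hU.mono (by rw [uIcc_of_le ha]; exact Icc_subset_Icc_right haT.le)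
    refine intervalIntegral.integral_mono_on ha ?_ ?_ fun t _ =>
      NeumannRobin.negMass_one_le hΩ.isBounded (he k) (he1 k) (U t)
    · exact ((NeumannRobin.continuous_negMass hΩ.isBounded one_pos).comp_continuousOn
        hUa).intervalIntegrable
    · exact ((NeumannRobin.continuous_negMass hΩ.isBounded (he k)).comp_continuousOn
        hUa).intervalIntegrable
  have hzero : ∀ t ∈ Ioo 0 T, NeumannRobin.negMass 1 (U t) = 0 := by
    intro t ht
    by_contra hne
    have hpos := (NeumannRobin.negMass_nonneg one_pos (U t)).lt_of_ne' hne
    have hlt : 0 < ∫ s in (0 : ℝ)..((t + T) / 2), NeumannRobin.negMass 1 (U s) :=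
      intervalIntegral.integral_pos (by linarith [ht.1, ht.2])
        (hmc.mono (Icc_subset_Icc_right (by linarith [ht.2])))
        (fun s _ => NeumannRobin.negMass_nonneg one_pos (U s))
        ⟨t, ⟨ht.1.le, by linarith [ht.2]⟩, hpos⟩
    exact hlt.not_ge (hint _ (by linarith [ht.1, ht.2]) (by linarith [ht.2]))
  have hval : ∀ᵐ t ∂(NeumannRobin.timeMeasure T), ∀ᵐ x ∂(NeumannRobin.vol Ω),
      0 ≤ NeumannRobin.val (u t) x := by
    filter_upwards [hUu, ae_restrict_mem measurableSet_Ioo] with t h1 h2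
    rw [← h1]
    exact NeumannRobin.nonneg_of_negMass_eq_zero hΩ.isBounded one_pos (hzero t h2)
  refine ⟨hval, ?_⟩
  filter_upwards [hval] with t ht
  exact ae_restrict_of_ae (NeumannRobin.trace_nonneg hΩ ht)
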